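/- For $z\in\mathbb C$ with $|z|\le 1$ and $v>0$ let $\Phi(z,s,v)$ be the Lerch zeta function, i.e. the analytic continuation in $s$, to $\mathbb C$ if $z\neq1$ and to $\mathbb C\setminus\{1\}$ if $z=1$, of $$\Phi(z,s,v)=\sum_{k=0}^\infty\frac{z^k}{(k+v)^s}\qquad(\mathrm{Re}\,s>1).$$ For $m\in\mathbb N_0$ put $\Phi(z,-m,0):=0^m+z\,\Phi(z,-m,1)$ with $0^0=1$ (the value at $v=0$ of the polynomial $v\mapsto\Phi(z,-m,v)$). Let $\zeta(s)$ be the Riemann zeta function, $\zeta(s,a)=\Phi(1,s,a)$ the Hurwitz zeta function and $\mathcal H_m=\sum_{j=1}^m\frac1j$. Let $\varphi\in\mathbb R$, $z=e^{i\varphi}$, $a,n\in\mathbb N_0$, $N\in\mathbb Z^+$ and $v>0$ real. There are remainders $R(z,-M,a,n,v)\in\mathbb C$ (for integers $M>n$) with the following properties. If $e^{i\varphi}\neq1$, then $$\frac{\partial\Phi}{\partial s}(e^{i\varphi},-n,v+a)=\sum_{m=0}^{n}v^{m}\binom nm\Phi(e^{i\varphi},m-n,a)\left(-\log v+\mathcal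 H_m-\mathcal H_n\right)+\sum_{m=1}^{N-1}\frac{\Phi(e^{i\varphi},-m-n,a)}{(-v)^{m}m\binom{m+n}{n}}+\frac{R(e^{i\varphi},-N-n,a,n,v)}{(-v)^{N}N\binom{N+n}{n}}.$$ If $e^{i\varphi}=1$, then $$\frac{\partial\Phi}{\partial s}(1,-n,v+a)=v^{n+1}\left(\frac{\log v}{n+1}-\frac1{(n+1)^2}\right)+\sum_{m=0}^{n}v^{m}\binom nm\Phi(1,m-n,a)\left(-\log v+\mathcal H_m-\mathcal H_n\right)+\sum_{m=1}^{N-1}\frac{\Phi(1,-m-n,a)}{(-v)^{m}m\binom{m+n}{n}}+\frac{R(1,-N-n,a,n,v)}{(-v)^{N}N\binom{N+n}{n}}.$$ In both cases the coefficient of $\log v$ displayed on the right hand side equals $-\Phi(e^{i\varphi},-n,v+a)$; that is, $\Phi(e^{i\varphi},-n,v+a)=\sum_{m=0}^n v^m\binom nm\Phi(e^{i\varphi},m-n,a)$ if $e^{i\varphi}\neq1$, and $\Phi(1,-n,v+a)=-\frac{v^{n+1}}{n+1}+\sum_{m=0}^n v^m\binom nm\Phi(1,m-n,a)$ if $e^{i\varphi}=1$.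 For every integer $M>n$ and every $v>0$, $$|R(e^{i\varphi},-M,a,n,v)|<\frac{M!}{(2\pi)^{M+1}}\left(\zeta\!\left(M+1,\tfrac{\varphi}{2\pi}\right)+\zeta\!\left(M+1,1-\tfrac{\varphi}{2\pi}\right)\right)+\zeta(-M)-\zeta(-M,a),$$ where in the two Hurwitz zeta values $\zeta(M+1,\cdot)$ the second argument is replaced by its representative modulo $1$ in $(0,1]$ (so nothing changes for $0<\varphi<2\pi$, and for $e^{i\varphi}=1$ both values are $\zeta(M+1)$). In particular, for fixed $\varphi,a,n,N$ these are asymptotic expansions for $v\to\infty$. -/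

import Mathlib

/-- `f` is the analytic continuation in `s` of the Lerch series `∑ z ^ k / (k + v) ^ s`: it is the
sum of the series for `Re s > 1`, and it is holomorphic on all of `ℂ` if `z ≠ 1`, and on `ℂ ∖ {1}`
if `z = 1`. Both domains are connected, so there is at most one such function on the domain. -/
def IsLerchContinuation (z v : ℂ) (f : ℂ → ℂ) : Prop :=
  DifferentiableOn ℂ f {s : ℂ | z ≠ 1 ∨ s ≠ 1} ∧
    ∀ s : ℂ, 1 < s.re → HasSum (fun k : ℕ => z ^ k / ((k : ℂ) + v) ^ s) (f s)

open Classical in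
/-- The analytic continuation of the Lerch series (with value `0` if there is none,
as for `‖z‖ > 1`). -/
noncomputable def lerchContinuation (z s v : ℂ) : ℂ :=
  if h : ∃ f : ℂ → ℂ, IsLerchContinuation z v f then h.choose s else 0

/-- The Lerch zeta function `Φ(z, s, v)`. At `v = 0` the series has the meaningless term `1 / 0 ^ s`;
there `Φ(z, s, 0) = 0 ^ (-s) + z Φ(z, s, 1)` with `0 ^ 0 = 1`, which for `s = 0, -1, -2, …` is the
value at `v = 0` of the polynomial `v ↦ Φ(z, s, v)`. (Only these `s` are meant when `v = 0`.) -/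
noncomputable def lerchPhi (z s v : ℂ) : ℂ :=
  if v = 0 then (0 : ℂ) ^ (-s) + z * lerchContinuation z s 1 else lerchContinuation z s v

/-- The constant
`C(e^{iφ}, -N, a) = N! / (2π)^{N+1} (ζ(N+1, φ/2π) + ζ(N+1, 1 - φ/2π)) + ζ(-N) - ζ(-N, a)`.
In the first two zeta values the second argument is taken modulo `1`, with representative in
`(0, 1]`: this is Mathlib's Hurwitz zeta function on `ℝ / ℤ`, whose value at the class of `0`
is the Riemann zeta function. The last one is the Hurwitz zeta function
`ζ(s, a) = Φ(1, s, a)`, which is not periodic in `a`. -/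
noncomputable def lerchBound (φ : ℝ) (N a : ℕ) : ℂ :=
  (N.factorial : ℂ) / (2 * (Real.pi : ℂ)) ^ (N + 1) *
      (HurwitzZeta.hurwitzZeta ((φ / (2 * Real.pi) : ℝ) : UnitAddCircle) ((N : ℂ) + 1) +
        HurwitzZeta.hurwitzZeta ((1 - φ / (2 * Real.pi) : ℝ) : UnitAddCircle) ((N : ℂ) + 1)) +
    riemannZeta (-(N : ℂ)) - lerchPhi 1 (-(N : ℂ)) (a : ℂ)

/-! For `Re s > 1`, `Γ(s) Φ(z, s, v + a)` is the Mellin transform of `e^{-vt} G(t)` with `G(t) =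
e^{-at} / (1 - z e^{-t})`. Subtract from `G` its Laurent polynomial at `0`, namely `res / t + ∑_{m <
M} c_m (-t)^m / m!`. The subtracted terms have explicit Mellin transforms. The remainder is
`O(t^M)`, so its transform is holomorphic for `Re s > -M`. This continues `Φ` explicitly to that
half plane (`lerchHalfPlane`).

At `s = -n` the factor `1/Γ` has a simple zero with derivative `(-1)^n n!`. The value there is thus
a polynomial in `v`, and comparing these polynomials for `a` and `a + 1` gives `c_m = Φ(z, -m, a)`
(`lerchPhi_neg_nat`). Differentiating (`hasDerivAt_lerchHalfPlane`), the Pochhammer factors with `m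
≤ n` produce the logarithm and the harmonic numbers, those with `m > n` the inverse powers of `v`,
and the Mellin integral at `-n` is the remainder.

The explicit bound comes from the Mittag-Leffler expansion of `1 / (1 - z e^{-t})`: its Taylor
remainder of order `M` is `∑ t^M / (p^M (t - p))` over the poles `p`. These are purely imaginary, so
`|t - p| > |p|` for `t > 0`, and `∑ |p|^{-M-1}` is a sum of two Hurwitz zeta values. Passing from
`0` to `a` costs `∑_{k < a} k^M = ζ(-M) - ζ(-M, a)`. -/

section LerchExpansion

open Complex Filter Topology Set MeasureTheory

/-! ### Mittag-Leffler expansion of `1 / (1 - e^{iφ} e^{-t})` -/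

/-- The poles `i (φ + 2 π k)` of `t ↦ 1 / (1 - e^{iφ} e^{-t})`. -/
noncomputable def lerchPole (φ : ℝ) (k : ℤ) : ℂ := ((φ + 2 * Real.pi * k : ℝ) : ℂ) * I

lemma summable_div_int_mul_sub (x : ℂ) : Summable fun k : ℤ => x / ((k : ℂ) * (x - k)) := by
  have h1 : Summable fun k : ℤ => (2 * ‖x‖) * (1 / (k : ℝ) ^ 2) :=
    (Real.summable_one_div_int_pow.mpr (by norm_num)).mul_left _
  refine Summable.of_norm_bounded_eventually h1 ?_
  have h2 : Tendsto (fun k : ℤ => ‖(k : ℂ)‖) cofinite atTop := by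
    have := tendsto_norm_cocompact_atTop.comp Int.isClosedEmbedding_coe_real.tendsto_cocompact
    rw [cocompact_eq_cofinite] at this
    refine this.congr fun k => ?_
    simp
  filter_upwards [h2.eventually_ge_atTop (2 * ‖x‖), h2.eventually_gt_atTop 0] with k hk hk0
  have h3 : ‖(k : ℂ)‖ / 2 ≤ ‖x - k‖ := by
    have := norm_sub_norm_le (k : ℂ) x
    rw [norm_sub_rev] at this
    linarith
  have h4 : ((k : ℝ)) ^ 2 = ‖(k : ℂ)‖ ^ 2 := by simp
  have h5 : 0 < ‖x - k‖ := by linarith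
  rw [norm_div, norm_mul, h4, mul_one_div, div_le_div_iff₀ (by positivity) (by positivity)]
  nlinarith [mul_nonneg (norm_nonneg x) hk0.le, mul_le_mul_of_nonneg_left h3
    (mul_nonneg (norm_nonneg x) hk0.le)]

/-- Pairing `k` with `-k` turns the absolutely convergent bilateral series into the classical
cotangent series. The term `k = 0` is `0` by the convention for division by zero. -/
lemma hasSum_int_cot {x : ℂ} (hx : x ∈ integerComplement) :
    HasSum (fun k : ℤ => x / ((k : ℂ) * (x - k))) (Real.pi * cot (Real.pi * x) - 1 / x) := by
  have hs := (summable_div_int_mul_sub x).hasSum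
  have h1 := hs.nat_add_neg
  have h2 := (hasSum_nat_add_iff' (f := fun n : ℕ => x / (((n : ℤ) : ℂ) * (x - ((n : ℤ) : ℂ)))
    + x / (((-(n : ℤ) : ℤ) : ℂ) * (x - ((-(n : ℤ) : ℤ) : ℂ)))) 1).mpr h1
  have h3 := cot_series_rep' hx
  have hne (m : ℤ) : x - m ≠ 0 := fun h =>
    hx ⟨m, (sub_eq_zero.mp h).symm⟩
  have h4 : (fun n : ℕ => x / ((((n + 1 : ℕ) : ℤ) : ℂ) * (x - (((n + 1 : ℕ) : ℤ) : ℂ)))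
    + x / (((-((n + 1 : ℕ) : ℤ) : ℤ) : ℂ) * (x - ((-((n + 1 : ℕ) : ℤ) : ℤ) : ℂ))))
      = fun n : ℕ => 1 / (x - (n + 1)) + 1 / (x + (n + 1)) := by
    funext n
    have a1 : x - (n + 1) ≠ 0 := by have := hne (n + 1); push_cast at this; exact this
    have a2 : x + (n + 1) ≠ 0 := by
      have := hne (-(n + 1)); push_cast at this
      rwa [sub_neg_eq_add] at this
    have a3 : (n : ℂ) + 1 ≠ 0 := Nat.cast_add_one_ne_zero n
    push_cast
    rw [sub_neg_eq_add]
    field_simp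
    ring
  rw [h4] at h2
  rw [h3, h2.tsum_eq]
  simpa using hs

/-- With `u = 2πix`, the function `1 / (1 - e^{-u}) - 1/2 = coth(u/2) / 2` is `π cot(πx) / (2πi)`.
The pole at `0` contributes a junk value `0` to the sum, which is why `1 / u` is split off. -/
lemma hasSum_int_one_div_one_sub_exp_neg {u : ℂ} (hu : ∀ k : ℤ, u ≠ lerchPole 0 k) :
    HasSum (fun k : ℤ => u / (lerchPole 0 k * (u - lerchPole 0 k)))
      (1 / (1 - exp (-u)) - 1 / 2 - 1 / u) := by
  have hp : 2 * Real.pi * I ≠ 0 := two_pi_I_ne_zero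
  have hpi : (Real.pi : ℂ) ≠ 0 := by exact_mod_cast Real.pi_ne_zero
  have hpole (k : ℤ) : lerchPole 0 k = 2 * Real.pi * I * k := by
    simp only [lerchPole]; push_cast; ring
  obtain ⟨x, rfl⟩ : ∃ x, u = 2 * Real.pi * I * x := ⟨u / (2 * Real.pi * I), by field_simp⟩
  have hx : x ∈ integerComplement := by
    rintro ⟨k, rfl⟩
    exact hu k (hpole k).symm
  have hx0 : x ≠ 0 := fun h => hx ⟨0, by simp [h]⟩
  have hexp : exp (2 * Real.pi * I * x) ≠ 1 := by
    intro h1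
    obtain ⟨k, hk⟩ := exp_eq_one_iff.mp h1
    apply hu k
    rw [hk, hpole]; ring
  have h := (hasSum_int_cot hx).mul_left (1 / (2 * Real.pi * I))
  have e1 (k : ℤ) : 2 * Real.pi * I * x / (lerchPole 0 k * (2 * Real.pi * I * x - lerchPole 0 k))
      = 1 / (2 * Real.pi * I) * (x / ((k : ℂ) * (x - k))) := by
    rw [hpole, ← mul_sub, mul_mul_mul_comm, mul_assoc (2 * Real.pi * I) (2 * Real.pi * I),
      mul_div_mul_left _ _ hp, one_div, ← div_eq_inv_mul, div_div,
      mul_comm ((k : ℂ) * (x - k))]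
  rw [funext e1]
  convert! h using 1
  rw [cot_pi_eq_exp_ratio, exp_neg]
  have h1 : 1 - exp (2 * Real.pi * I * x) ≠ 0 := sub_ne_zero.mpr (Ne.symm hexp)
  have h2 : exp (2 * Real.pi * I * x) - 1 ≠ 0 := sub_ne_zero.mpr hexp
  have h3 := exp_ne_zero (2 * Real.pi * I * x)
  generalize exp (2 * Real.pi * I * x) = q at *
  have h4 : 1 / (1 - q⁻¹) = q / (q - 1) := by field_simp
  rw [h4, show q - 1 = -(1 - q) by ring]
  field_simp
  linear_combination (-(q + 1) * Real.pi * x) * I_sq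

lemma lerchPole_ne_zero {φ : ℝ} (h : exp (φ * I) ≠ 1) (k : ℤ) : lerchPole φ k ≠ 0 := by
  intro hk
  apply h
  rw [exp_eq_one_iff]
  refine ⟨-k, ?_⟩
  simp only [lerchPole] at hk
  push_cast at hk ⊢
  linear_combination hk

lemma lerchPole_re (φ : ℝ) (k : ℤ) : (lerchPole φ k).re = 0 := by simp [lerchPole]

lemma norm_lerchPole_lt_norm_sub (φ : ℝ) (k : ℤ) {t : ℝ} (ht : 0 < t) :
    ‖lerchPole φ k‖ < ‖(t : ℂ) - lerchPole φ k‖ := by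
  rw [← sq_lt_sq₀ (norm_nonneg _) (norm_nonneg _), ← normSq_eq_norm_sq, ← normSq_eq_norm_sq,
    normSq_apply, normSq_apply]
  simp [lerchPole_re]
  positivity

lemma sub_lerchPole_ne_zero (φ : ℝ) (k : ℤ) {t : ℝ} (ht : 0 < t) :
    (t : ℂ) - lerchPole φ k ≠ 0 :=
  norm_pos_iff.mp ((norm_nonneg _).trans_lt (norm_lerchPole_lt_norm_sub φ k ht))

open Classical in
/-- The residue at `t = 0` of `t ↦ 1 / (1 - z e^{-t})`, for `‖z‖ = 1`. -/
noncomputable def lerchResidue (z : ℂ) : ℂ := if z = 1 then 1 else 0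

lemma exists_hasSum_lerchPole (φ : ℝ) : ∃ c : ℂ, ∀ t : ℝ, 0 < t →
    HasSum (fun k : ℤ => (t : ℂ) / (lerchPole φ k * (t - lerchPole φ k)))
      (1 / (1 - exp (φ * I) * exp (-t)) - lerchResidue (exp (φ * I)) / t - c) := by
  have hshift (k : ℤ) : lerchPole φ k = lerchPole 0 k + φ * I := by
    simp only [lerchPole]; push_cast; ring
  by_cases hz : exp (φ * I) = 1
  · refine ⟨1 / 2, fun t ht => ?_⟩
    obtain ⟨j, hj⟩ := exp_eq_one_iff.mp hz
    have h := hasSum_int_one_div_one_sub_exp_neg (u := t) fun k =>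
      sub_ne_zero.mp (sub_lerchPole_ne_zero 0 k ht)
    -- Here `φ = 2πj`, so the poles are those for `φ = 0` with shifted labels.
    rw [← (Equiv.addRight j).hasSum_iff] at h
    have e1 (k : ℤ) : lerchPole 0 (k + j) = lerchPole φ k := by
      rw [hshift, hj]; simp only [lerchPole]; push_cast; ring
    simp only [Function.comp_def, Equiv.coe_addRight, e1] at h
    rw [hz, lerchResidue, if_pos rfl, one_mul]
    convert! h using 1
    ring
  · refine ⟨1 / (1 - exp (φ * I)), fun t ht => ?_⟩
    rw [lerchResidue, if_neg hz, zero_div]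
    have hne := lerchPole_ne_zero hz
    have h1 := hasSum_int_one_div_one_sub_exp_neg (u := t - φ * I) fun k h => by
      apply sub_lerchPole_ne_zero φ k ht
      rw [hshift, ← h]; ring
    have h2 := hasSum_int_one_div_one_sub_exp_neg (u := -(φ * I)) fun k h => by
      apply hne k
      rw [hshift, ← h]; ring
    -- The expansion is the one at `t - iφ` minus the one at `-iφ`. The split-off terms `1 / u` go
    -- back in at index `0`, which is now a genuine pole.
    have h3 := hasSum_ite_eq (0 : ℤ) (1 / ((t : ℂ) - φ * I) - 1 / (-(φ * I)))
    have h4 := (h1.sub h2).add h3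
    convert! h4 using 1
    · funext k
      have b1 : (t : ℂ) - (lerchPole 0 k + φ * I) ≠ 0 := by
        rw [← hshift]; exact sub_lerchPole_ne_zero φ k ht
      have b2 : lerchPole 0 k + φ * I ≠ 0 := by rw [← hshift]; exact hne k
      rw [hshift]
      by_cases hk : k = 0
      · subst hk
        have h0 : lerchPole 0 0 = 0 := by simp [lerchPole]
        rw [h0, zero_add] at b1 b2 ⊢
        simp only [zero_mul, div_zero, sub_zero, if_true]
        generalize (φ : ℂ) * I = w at *
        field_simp
        ring
      · have b3 : lerchPole 0 k ≠ 0 := by simp [lerchPole, hk, Real.pi_ne_zero]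
        have b4 : (t : ℂ) - φ * I - lerchPole 0 k ≠ 0 := by
          intro h; apply b1; linear_combination h
        have b5 : -((φ : ℂ) * I) - lerchPole 0 k ≠ 0 := by
          intro h; apply b2; linear_combination -h
        rw [if_neg hk, add_zero, div_sub_div _ _ (mul_ne_zero b3 b4) (mul_ne_zero b3 b5),
          div_eq_div_iff (mul_ne_zero b2 b1)
            (mul_ne_zero (mul_ne_zero b3 b4) (mul_ne_zero b3 b5))]
        ring
    · rw [neg_neg, neg_sub, sub_eq_add_neg (φ * I) (t : ℂ), exp_add]
      ring_nf

/-- The poles have modulus `2π |k + φ/2π|`, and the bilateral sum is twice the even Hurwitz zeta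
function, i.e. `ζ(s, x) + ζ(s, -x)`. A pole at `0` contributes `0`. -/
lemma hasSum_norm_lerchPole (φ : ℝ) {M : ℕ} (hM : 1 ≤ M) :
    HasSum (fun k : ℤ => ((1 / ‖lerchPole φ k‖ ^ (M + 1) : ℝ) : ℂ))
      (1 / (2 * (Real.pi : ℂ)) ^ (M + 1) *
        (HurwitzZeta.hurwitzZeta ((φ / (2 * Real.pi) : ℝ) : UnitAddCircle) ((M : ℂ) + 1) +
          HurwitzZeta.hurwitzZeta ((1 - φ / (2 * Real.pi) : ℝ) : UnitAddCircle) ((M : ℂ) + 1))) := by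
  have hs : 1 < ((M : ℂ) + 1).re := by simpa using Nat.pos_of_ne_zero (by omega)
  have h := (HurwitzZeta.hasSum_int_hurwitzZetaEven (φ / (2 * Real.pi)) hs).mul_left
    (2 * (1 / (2 * (Real.pi : ℂ)) ^ (M + 1)))
  have hc : ((1 - φ / (2 * Real.pi) : ℝ) : UnitAddCircle)
      = -((φ / (2 * Real.pi) : ℝ) : UnitAddCircle) := by
    rw [QuotientAddGroup.mk_sub]
    have : ((1 : ℝ) : UnitAddCircle) = 0 := AddCircle.coe_period 1
    rw [this, zero_sub]
  rw [hc]
  convert! h using 1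
  · funext k
    have h1 : ‖lerchPole φ k‖ = 2 * Real.pi * |k + φ / (2 * Real.pi)| := by
      rw [lerchPole, norm_mul, norm_I, mul_one, norm_real, Real.norm_eq_abs]
      rw [← abs_of_pos (show 0 < 2 * Real.pi by positivity), ← abs_mul]
      simp only [abs_of_pos (show 0 < 2 * Real.pi by positivity)]
      congr 1
      field_simp
      ring
    rw [h1, show ((M : ℂ) + 1) = ((M + 1 : ℕ) : ℂ) by push_cast; rfl, cpow_natCast]
    push_cast
    rw [mul_pow]
    ring
  · rw [HurwitzZeta.hurwitzZetaEven_eq]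
    ring

lemma summable_norm_lerchPole (φ : ℝ) {M : ℕ} (hM : 1 ≤ M) :
    Summable fun k : ℤ => 1 / ‖lerchPole φ k‖ ^ (M + 1) :=
  Complex.summable_ofReal.mp (hasSum_norm_lerchPole φ hM).summable

/-- Since `t^M / (p^M (t - p)) + t^M / p^{M+1} = t^{M+1} / (p^{M+1} (t - p))`, raising `M` by one
peels off one Taylor coefficient, a power sum over the poles. The coefficients do not depend on `M`.
-/
lemma exists_hasSum_lerchPole_pow (φ : ℝ) : ∃ c : ℕ → ℂ, ∀ M : ℕ, 1 ≤ M → ∀ t : ℝ, 0 < t →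
    HasSum (fun k : ℤ => (t : ℂ) ^ M / (lerchPole φ k ^ M * (t - lerchPole φ k)))
      (1 / (1 - exp (φ * I) * exp (-t)) - lerchResidue (exp (φ * I)) / t
        - ∑ m ∈ Finset.range M, c m * (-t) ^ m / (m.factorial : ℂ)) := by
  obtain ⟨c₀, hc₀⟩ := exists_hasSum_lerchPole φ
  let S (m : ℕ) : ℂ := ∑' k : ℤ, 1 / lerchPole φ k ^ (m + 1)
  let c (m : ℕ) : ℂ := if m = 0 then c₀ else -((-1) ^ m * (m.factorial : ℂ) * S m)
  refine ⟨c, fun M hM t ht => ?_⟩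
  induction M, hM using Nat.le_induction with
  | base => simpa [c] using hc₀ t ht
  | succ M hM ih =>
    have hS : HasSum (fun k : ℤ => (t : ℂ) ^ M * (1 / lerchPole φ k ^ (M + 1)))
        ((t : ℂ) ^ M * S M) := by
      refine (Summable.hasSum ?_).mul_left _
      refine Summable.of_norm ?_
      simpa using summable_norm_lerchPole φ hM
    have h := ih.add hS
    convert! h using 1
    · funext k
      by_cases hk : lerchPole φ k = 0
      · simp [hk, show M ≠ 0 by omega]
      · have := sub_lerchPole_ne_zero φ k ht
        field_simp
        ring
    · rw [Finset.sum_range_succ]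
      have hM0 : M ≠ 0 := by omega
      have hf : (M.factorial : ℂ) ≠ 0 := by exact_mod_cast M.factorial_ne_zero
      simp only [c, if_neg hM0]
      have h1 : -((-1) ^ M * (M.factorial : ℂ) * S M) * (-(t : ℂ)) ^ M / (M.factorial : ℂ)
          = -((t : ℂ) ^ M * S M) := by
        rw [neg_pow (t : ℂ)]
        have h2 : ((-1 : ℂ) ^ M) * (-1) ^ M = 1 := by rw [← mul_pow]; simp
        field_simp
        linear_combination (-(S M) * (t : ℂ) ^ M) * h2
      rw [h1]
      ring

/-! ### Bounds for the Laurent remainder -/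

/-- The signed remainder of order `M + 1` vanishes at `0` and has the one of order `M` as
derivative, so both inequalities follow inductively by monotonicity. -/
lemma neg_one_pow_mul_exp_neg_sub_mem_Icc (M : ℕ) {x : ℝ} (hx : 0 ≤ x) :
    (-1) ^ M * (Real.exp (-x) - ∑ m ∈ Finset.range M, (-x) ^ m / (m.factorial : ℝ)) ∈
      Icc 0 (x ^ M / (M.factorial : ℝ)) := by
  induction M generalizing x with
  | zero => simpa using ⟨(Real.exp_pos _).le, hx⟩
  | succ M ih =>
    let E (M : ℕ) (x : ℝ) : ℝ :=
      (-1) ^ M * (Real.exp (-x) - ∑ m ∈ Finset.range M, (-x) ^ m / (m.factorial : ℝ))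
    have hE (x : ℝ) : HasDerivAt (E (M + 1)) (E M x) x := by
      have h1 : HasDerivAt (fun x : ℝ => Real.exp (-x)) (-Real.exp (-x)) x := by
        simpa using (hasDerivAt_neg x).exp
      have h2 : HasDerivAt (fun x : ℝ => ∑ m ∈ Finset.range (M + 1), (-x) ^ m / (m.factorial : ℝ))
          (-∑ m ∈ Finset.range M, (-x) ^ m / (m.factorial : ℝ)) x := by
        simp only [Finset.sum_range_succ']
        rw [← Finset.sum_neg_distrib]
        simp only [pow_zero]
        refine HasDerivAt.add_const _ (HasDerivAt.fun_sum fun m _ => ?_)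
        have h3 := ((hasDerivAt_neg x).pow (m + 1)).div_const ((m + 1).factorial : ℝ)
        convert! h3 using 1
        have : (m.factorial : ℝ) ≠ 0 := by exact_mod_cast m.factorial_ne_zero
        rw [Nat.factorial_succ]
        push_cast
        field_simp
      convert! ((h1.sub h2).const_mul ((-1) ^ (M + 1))) using 1
      simp only [E, pow_succ]
      ring
    have hE0 : E (M + 1) 0 = 0 := by
      simp [E, Finset.sum_range_succ']
    have hP (x : ℝ) : HasDerivAt (fun x : ℝ => x ^ (M + 1) / ((M + 1).factorial : ℝ))
        (x ^ M / (M.factorial : ℝ)) x := by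
      have h3 := (hasDerivAt_pow (M + 1) x).div_const ((M + 1).factorial : ℝ)
      convert! h3 using 1
      have : (M.factorial : ℝ) ≠ 0 := by exact_mod_cast M.factorial_ne_zero
      rw [Nat.factorial_succ]
      push_cast
      field_simp
    constructor
    · have : MonotoneOn (E (M + 1)) (Ici 0) := by
        refine monotoneOn_of_hasDerivWithinAt_nonneg (convex_Ici 0)
          (fun y _ => (hE y).continuousAt.continuousWithinAt)
          (fun y _ => (hE y).hasDerivWithinAt) fun y hy => ?_
        exact (ih (by rw [interior_Ici] at hy; exact (mem_Ioi.mp hy).le)).1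
      have h := this (mem_Ici.mpr le_rfl) (mem_Ici.mpr hx) hx
      rwa [hE0] at h
    · have : MonotoneOn (fun x => x ^ (M + 1) / ((M + 1).factorial : ℝ) - E (M + 1) x) (Ici 0) := by
        refine monotoneOn_of_hasDerivWithinAt_nonneg (convex_Ici 0)
          (fun y _ => ((hP y).sub (hE y)).continuousAt.continuousWithinAt)
          (fun y _ => ((hP y).sub (hE y)).hasDerivWithinAt) fun y hy => ?_
        have := (ih (x := y) (by rw [interior_Ici] at hy; exact (mem_Ioi.mp hy).le)).2
        exact sub_nonneg.mpr this
      have h := this (mem_Ici.mpr le_rfl) (mem_Ici.mpr hx) hx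
      simp only [hE0] at h
      simp only [ne_eq, Nat.add_eq_zero_iff, one_ne_zero, and_false, not_false_eq_true, zero_pow,
        zero_div, sub_zero] at h
      linarith

lemma norm_exp_neg_sub_le (M : ℕ) {x : ℝ} (hx : 0 ≤ x) :
    ‖exp (-(x : ℂ)) - ∑ m ∈ Finset.range M, (-(x : ℂ)) ^ m / (m.factorial : ℂ)‖ ≤
      x ^ M / (M.factorial : ℝ) := by
  have h := neg_one_pow_mul_exp_neg_sub_mem_Icc M hx
  have h1 : exp (-(x : ℂ)) - ∑ m ∈ Finset.range M, (-(x : ℂ)) ^ m / (m.factorial : ℂ)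
      = ((Real.exp (-x) - ∑ m ∈ Finset.range M, (-x) ^ m / (m.factorial : ℝ) : ℝ) : ℂ) := by
    push_cast; rfl
  rw [h1, norm_real, Real.norm_eq_abs]
  have h2 := h.2
  rw [← abs_of_nonneg h.1, abs_mul, abs_pow, abs_neg, abs_one, one_pow, one_mul] at h2
  exact h2

/-- The constant in the bound for the Taylor remainder of order `M` of
`t ↦ e^{-at} / (1 - e^{iφ} e^{-t})`. -/
noncomputable def lerchRemBound (φ : ℝ) (M a : ℕ) : ℝ :=
  (M.factorial : ℝ) * (∑' k : ℤ, 1 / ‖lerchPole φ k‖ ^ (M + 1)) +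
    ∑ k ∈ Finset.range a, (k : ℝ) ^ M

/-- The remainder of the Laurent expansion of `t ↦ e^{-at} / (1 - z e^{-t})` at `0`, the
coefficient of `(-t) ^ m / m!` being `c m`. -/
noncomputable def lerchRem (c : ℕ → ℂ) (z : ℂ) (M a : ℕ) (t : ℝ) : ℂ :=
  exp (-(a * t)) / (1 - z * exp (-t)) - lerchResidue z / t
    - ∑ m ∈ Finset.range M, c m * (-t) ^ m / (m.factorial : ℂ)

/-- Termwise `|t - p| > |p|`. Strictness of the sum needs one nonzero pole, and at most one of the
poles of index `0` and `1` vanishes. -/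
lemma norm_tsum_lerchPole_lt (φ : ℝ) {M : ℕ} (hM : 1 ≤ M) {t : ℝ} (ht : 0 < t) {A : ℂ}
    (hA : HasSum (fun k : ℤ => (t : ℂ) ^ M / (lerchPole φ k ^ M * (t - lerchPole φ k))) A) :
    ‖A‖ < (∑' k : ℤ, 1 / ‖lerchPole φ k‖ ^ (M + 1)) * t ^ M := by
  have hb := (summable_norm_lerchPole φ hM).mul_right (t ^ M)
  have hle (k : ℤ) : ‖(t : ℂ) ^ M / (lerchPole φ k ^ M * (t - lerchPole φ k))‖
      ≤ 1 / ‖lerchPole φ k‖ ^ (M + 1) * t ^ M := by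
    by_cases hk : lerchPole φ k = 0
    · simp [hk, show M ≠ 0 by omega]
    have h0 : 0 < ‖lerchPole φ k‖ := norm_pos_iff.mpr hk
    rw [norm_div, norm_mul, norm_pow, norm_pow, norm_real, Real.norm_of_nonneg ht.le,
      div_mul_eq_mul_div, one_mul, pow_succ]
    gcongr
    exact (norm_lerchPole_lt_norm_sub φ k ht).le
  obtain ⟨k, hk⟩ : ∃ k, lerchPole φ k ≠ 0 := by
    by_contra! h
    have h0 := h 0
    have h1 := h 1
    simp only [lerchPole, mul_eq_zero, I_ne_zero, or_false, ofReal_eq_zero, Int.cast_zero,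
      Int.cast_one] at h0 h1
    linarith [Real.pi_pos]
  have hlt : ‖(t : ℂ) ^ M / (lerchPole φ k ^ M * (t - lerchPole φ k))‖
      < 1 / ‖lerchPole φ k‖ ^ (M + 1) * t ^ M := by
    have h0 : 0 < ‖lerchPole φ k‖ := norm_pos_iff.mpr hk
    rw [norm_div, norm_mul, norm_pow, norm_pow, norm_real, Real.norm_of_nonneg ht.le,
      div_mul_eq_mul_div, one_mul, pow_succ]
    gcongr
    exact norm_lerchPole_lt_norm_sub φ k ht
  have hs := Summable.of_nonneg_of_le (fun _ => norm_nonneg _) hle hb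
  rw [← hA.tsum_eq, ← tsum_mul_right]
  exact (norm_tsum_le_tsum_norm hs).trans_lt (hs.tsum_lt_tsum hle hlt hb)

lemma one_sub_mul_exp_neg_ne_zero {z : ℂ} (hz : ‖z‖ = 1) {t : ℝ} (ht : 0 < t) :
    1 - z * exp (-t) ≠ 0 := by
  intro h
  have h2 : ‖z * exp (-t)‖ = 1 := by rw [← sub_eq_zero.mp h, norm_one]
  rw [norm_mul, hz, one_mul, norm_exp] at h2
  have : Real.exp (-t) < 1 := Real.exp_lt_one_iff.mpr (by linarith)
  simp at h2
  linarith

/-- The finite geometric sum gives `z^a e^{-at} / (1 - z e^{-t}) = 1 / (1 - z e^{-t}) - ∑_{k < a}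
z^k e^{-kt}`. The first term is controlled by the poles, the others by the Taylor remainder of the
exponential; as `|z| = 1`, the factor `z^a` is harmless. -/
lemma exists_norm_lerchRem_lt (φ : ℝ) : ∃ c : ℕ → ℕ → ℂ,
    (∀ a m : ℕ, exp (φ * I) ^ a * c a m =
      c 0 m - ∑ k ∈ Finset.range a, exp (φ * I) ^ k * (k : ℂ) ^ m) ∧
    ∀ a M : ℕ, 1 ≤ M → ∀ t : ℝ, 0 < t →
      ‖lerchRem (c a) (exp (φ * I)) M a t‖ < lerchRemBound φ M a * (t ^ M / (M.factorial : ℝ)) := by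
  obtain ⟨c₀, hc₀⟩ := exists_hasSum_lerchPole_pow φ
  have hnorm : ‖exp (φ * I)‖ = 1 := norm_exp_ofReal_mul_I φ
  have hz0 := exp_ne_zero (φ * I)
  -- The residue is nonzero only for `z = 1`, so multiplying by `z^a` preserves it.
  have hres : ∀ a : ℕ, exp (φ * I) ^ a * lerchResidue (exp (φ * I))
      = lerchResidue (exp (φ * I)) := by
    intro a
    unfold lerchResidue
    split_ifs with h
    · simp [h]
    · simp
  generalize exp (φ * I) = z at *
  refine ⟨fun a m => (z ^ a)⁻¹ * (c₀ m - ∑ k ∈ Finset.range a, z ^ k * (k : ℂ) ^ m), ?_, ?_⟩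
  · intro a m
    simp [hz0]
  · intro a M hM t ht
    have h1 := norm_tsum_lerchPole_lt φ hM ht (hc₀ M hM t ht)
    set g := 1 / (1 - z * exp (-t)) - lerchResidue z / t
        - ∑ m ∈ Finset.range M, c₀ m * (-t) ^ m / (m.factorial : ℂ) with hg
    have hden := one_sub_mul_exp_neg_ne_zero hnorm ht
    have h2 : z ^ a * lerchRem (fun m => (z ^ a)⁻¹ * (c₀ m - ∑ k ∈ Finset.range a,
        z ^ k * (k : ℂ) ^ m)) z M a t = g - ∑ k ∈ Finset.range a, z ^ k *
          (exp (-((k * t : ℝ) : ℂ)) - ∑ m ∈ Finset.range M,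
            (-((k * t : ℝ) : ℂ)) ^ m / (m.factorial : ℂ)) := by
      have hza : z ^ a ≠ 0 := pow_ne_zero _ hz0
      have e1 : z ^ a * (exp (-(a * t)) / (1 - z * exp (-t)))
          = 1 / (1 - z * exp (-t)) - ∑ k ∈ Finset.range a, z ^ k * exp (-((k * t : ℝ) : ℂ)) := by
        have e2 (k : ℕ) : z ^ k * exp (-((k * t : ℝ) : ℂ)) = (z * exp (-t)) ^ k := by
          rw [mul_pow, ← exp_nat_mul]; push_cast; ring_nf
        simp only [e2]
        have e3 := mul_neg_geom_sum (z * exp (-t)) a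
        have e4 := e2 a
        push_cast at e4
        rw [← mul_div_assoc, e4]
        field_simp
        linear_combination e3
      rw [lerchRem, mul_sub, mul_sub, e1, ← mul_div_assoc, hres, hg, Finset.mul_sum]
      have e5 : ∑ m ∈ Finset.range M, z ^ a * ((z ^ a)⁻¹ * (c₀ m - ∑ k ∈ Finset.range a,
          z ^ k * (k : ℂ) ^ m) * (-t) ^ m / (m.factorial : ℂ))
          = ∑ m ∈ Finset.range M, c₀ m * (-t) ^ m / (m.factorial : ℂ) -
            ∑ k ∈ Finset.range a, z ^ k * ∑ m ∈ Finset.range M,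
            (-((k * t : ℝ) : ℂ)) ^ m / (m.factorial : ℂ) := by
        simp only [Finset.mul_sum]
        rw [Finset.sum_comm, ← Finset.sum_sub_distrib]
        refine Finset.sum_congr rfl fun m _ => ?_
        have e6 : ∑ k ∈ Finset.range a, z ^ k * ((-((k * t : ℝ) : ℂ)) ^ m / (m.factorial : ℂ))
            = (∑ k ∈ Finset.range a, z ^ k * (k : ℂ) ^ m) * (-t) ^ m / (m.factorial : ℂ) := by
          rw [Finset.sum_mul, Finset.sum_div]
          refine Finset.sum_congr rfl fun k _ => ?_
          push_cast
          rw [← mul_neg, mul_pow]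
          ring
        rw [e6, mul_div_assoc, mul_assoc, mul_inv_cancel_left₀ hza]
        ring
      rw [e5]
      simp only [mul_sub, Finset.sum_sub_distrib]
      ring
    have h3 : ‖lerchRem (fun m => (z ^ a)⁻¹ * (c₀ m - ∑ k ∈ Finset.range a,
        z ^ k * (k : ℂ) ^ m)) z M a t‖ = ‖g - ∑ k ∈ Finset.range a, z ^ k *
          (exp (-((k * t : ℝ) : ℂ)) - ∑ m ∈ Finset.range M,
            (-((k * t : ℝ) : ℂ)) ^ m / (m.factorial : ℂ))‖ := by
      rw [← h2, norm_mul, norm_pow, hnorm, one_pow, one_mul]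
    rw [h3]
    have h4 : ‖∑ k ∈ Finset.range a, z ^ k *
          (exp (-((k * t : ℝ) : ℂ)) - ∑ m ∈ Finset.range M,
            (-((k * t : ℝ) : ℂ)) ^ m / (m.factorial : ℂ))‖
        ≤ ∑ k ∈ Finset.range a, (k : ℝ) ^ M * (t ^ M / (M.factorial : ℝ)) := by
      refine norm_sum_le_of_le _ fun k _ => ?_
      rw [norm_mul, norm_pow, hnorm, one_pow, one_mul]
      refine (norm_exp_neg_sub_le M (by positivity)).trans (le_of_eq ?_)
      rw [mul_pow]; ring
    refine (norm_sub_le _ _).trans_lt ((add_lt_add_of_lt_of_le h1 h4).trans_le (le_of_eq ?_))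
    rw [lerchRemBound, ← Finset.sum_mul, add_mul]
    have hf : (M.factorial : ℝ) ≠ 0 := by exact_mod_cast M.factorial_ne_zero
    field_simp

lemma continuousOn_lerchRem (c : ℕ → ℂ) {z : ℂ} (hz : ‖z‖ = 1) (M a : ℕ) :
    ContinuousOn (lerchRem c z M a) (Ioi 0) := by
  unfold lerchRem
  refine ContinuousOn.sub (ContinuousOn.sub ?_ ?_) ?_
  · refine ContinuousOn.div (by fun_prop) (by fun_prop) fun t ht =>
      one_sub_mul_exp_neg_ne_zero hz ht
  · refine ContinuousOn.div (by fun_prop) (by fun_prop) fun t ht => ?_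
    exact_mod_cast (mem_Ioi.mp ht).ne'
  · fun_prop

/-! ### Mellin transforms and analytic continuation -/

lemma hasMellin_exp_neg_mul_cpow {v : ℝ} (hv : 0 < v) (w : ℂ) {s : ℂ} (hs : 0 < (s + w).re) :
    HasMellin (fun t : ℝ => (t : ℂ) ^ w * exp (-(v * t))) s (Gamma (s + w) * (v : ℂ) ^ (-(s + w))) := by
  have h := mellin_cpow_smul (fun t : ℝ => exp (-((v : ℂ) * t))) s w
  simp only [smul_eq_mul] at h
  constructor
  · have h1 := MellinConvergent.cpow_smul (f := fun t : ℝ => exp (-((v : ℂ) * t))) (s := s) (a := w)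
    simp only [smul_eq_mul] at h1
    rw [h1]
    refine mellinConvergent_of_isBigO_rpow_exp (a := v) (b := 0) hv ?_ ?_ ?_ hs
    · exact (Continuous.continuousOn (by fun_prop)).locallyIntegrableOn measurableSet_Ioi
    · refine Asymptotics.isBigO_of_le _ fun t => ?_
      rw [norm_exp]
      simp
    · refine Asymptotics.IsBigO.of_bound 1 ?_
      filter_upwards [self_mem_nhdsWithin] with t ht
      rw [norm_exp]
      have : 0 ≤ v * t := (mul_pos hv ht).le
      simpa using this
  · rw [h, mellin]
    simp only [smul_eq_mul]
    rw [integral_cpow_mul_exp_neg_mul_Ioi hs hv, mul_comm, one_div,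
      inv_cpow _ _ (by rw [arg_ofReal_of_nonneg hv.le]; exact Real.pi_pos.ne), cpow_neg]

section Continuation

variable {c : ℕ → ℂ} {z : ℂ} {a : ℕ} {B : ℕ → ℝ} {v : ℝ}

/-- `e^{-vt}` times the remainder of the Laurent expansion of `t ↦ e^{-at} / (1 - z e^{-t})`. -/
noncomputable def lerchKernel (c : ℕ → ℂ) (z : ℂ) (M a : ℕ) (v t : ℝ) : ℂ :=
  exp (-(v * t)) * lerchRem c z M a t

lemma locallyIntegrableOn_lerchKernel (hz : ‖z‖ = 1) (M : ℕ) :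
    LocallyIntegrableOn (lerchKernel c z M a v) (Ioi 0) :=
  ContinuousOn.locallyIntegrableOn
    (ContinuousOn.mul (by fun_prop) (continuousOn_lerchRem c hz M a)) measurableSet_Ioi

lemma isBigO_lerchKernel_atTop (hv : 0 < v) {M : ℕ}
    (hB : ∀ t : ℝ, 0 < t → ‖lerchRem c z M a t‖ ≤ B M * t ^ M) :
    lerchKernel c z M a v =O[atTop] fun t => Real.exp (-(v / 2) * t) := by
  have h1 : lerchKernel c z M a v =O[atTop] fun t => Real.exp (-v * t) * t ^ M := by
    refine Asymptotics.IsBigO.of_bound (B M) ?_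
    filter_upwards [eventually_gt_atTop 0] with t ht
    rw [lerchKernel, norm_mul, norm_exp, norm_mul, norm_pow, Real.norm_of_nonneg ht.le,
      Real.norm_of_nonneg (Real.exp_pos _).le]
    have := mul_le_mul_of_nonneg_left (hB t ht) (Real.exp_pos (-v * t)).le
    calc _ = Real.exp (-v * t) * ‖lerchRem c z M a t‖ := by simp
      _ ≤ _ := this
      _ = _ := by ring
  -- Half of the exponential decay absorbs the power `t^M`.
  have h2 := (isLittleO_pow_exp_pos_mul_atTop M (half_pos hv)).isBigO
  refine h1.trans (((Asymptotics.isBigO_refl (fun t => Real.exp (-v * t)) _).mul h2).trans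
    (Asymptotics.isBigO_of_le _ fun t => ?_))
  rw [← Real.exp_add]
  ring_nf
  rfl

lemma isBigO_lerchKernel_zero (hv : 0 < v) {M : ℕ}
    (hB : ∀ t : ℝ, 0 < t → ‖lerchRem c z M a t‖ ≤ B M * t ^ M) :
    lerchKernel c z M a v =O[𝓝[>] 0] fun t => t ^ (-(-(M : ℝ))) := by
  refine Asymptotics.IsBigO.of_bound (B M) ?_
  filter_upwards [self_mem_nhdsWithin] with t ht
  have ht : 0 < t := ht
  rw [neg_neg, Real.rpow_natCast, norm_pow, Real.norm_of_nonneg ht.le, lerchKernel, norm_mul,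
    norm_exp]
  refine le_trans ?_ (hB t ht)
  refine mul_le_of_le_one_left (norm_nonneg _) (Real.exp_le_one_iff.mpr ?_)
  have : 0 ≤ v * t := (mul_pos hv ht).le
  simpa using this

lemma mellinConvergent_lerchKernel (hz : ‖z‖ = 1) (hv : 0 < v) {M : ℕ}
    (hB : ∀ t : ℝ, 0 < t → ‖lerchRem c z M a t‖ ≤ B M * t ^ M) {s : ℂ} (hs : -(M : ℝ) < s.re) :
    MellinConvergent (lerchKernel c z M a v) s :=
  mellinConvergent_of_isBigO_rpow_exp (half_pos hv) (locallyIntegrableOn_lerchKernel hz M)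
    (isBigO_lerchKernel_atTop hv hB) (isBigO_lerchKernel_zero hv hB) hs

lemma differentiableAt_mellin_lerchKernel (hz : ‖z‖ = 1) (hv : 0 < v) {M : ℕ}
    (hB : ∀ t : ℝ, 0 < t → ‖lerchRem c z M a t‖ ≤ B M * t ^ M) {s : ℂ} (hs : -(M : ℝ) < s.re) :
    DifferentiableAt ℂ (mellin (lerchKernel c z M a v)) s :=
  mellin_differentiableAt_of_isBigO_rpow_exp (half_pos hv) (locallyIntegrableOn_lerchKernel hz M)
    (isBigO_lerchKernel_atTop hv hB) (isBigO_lerchKernel_zero hv hB) hs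

/-- The analytic continuation of the Lerch series in the half plane `-M < Re s`. -/
noncomputable def lerchHalfPlane (c : ℕ → ℂ) (z : ℂ) (a : ℕ) (v : ℝ) (M : ℕ) (s : ℂ) : ℂ :=
  lerchResidue z * (v : ℂ) ^ (1 - s) / (s - 1) +
    ∑ m ∈ Finset.range M, c m * ((-1) ^ m / (m.factorial : ℂ)) *
      ((∏ j ∈ Finset.range m, (s + j)) * (v : ℂ) ^ (-(s + m))) +
    (Gamma s)⁻¹ * mellin (lerchKernel c z M a v) s

lemma inv_Gamma_eq_prod_mul (s : ℂ) (m : ℕ) :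
    (Gamma s)⁻¹ = (∏ j ∈ Finset.range m, (s + j)) * (Gamma (s + m))⁻¹ := by
  induction m with
  | zero => simp
  | succ m ih =>
    rw [ih, Finset.prod_range_succ, one_div_Gamma_eq_self_mul_one_div_Gamma_add_one (s + m)]
    push_cast
    ring_nf

/-- Raising `M` moves the term `m = M` out of the Mellin integral into the finite sum; `Γ(s + M) /
Γ(s)` is the Pochhammer product. The term is integrable because `Re s > -M`. -/
lemma lerchHalfPlane_succ (hz : ‖z‖ = 1) (hv : 0 < v) {M : ℕ}
    (hB : ∀ t : ℝ, 0 < t → ‖lerchRem c z (M + 1) a t‖ ≤ B (M + 1) * t ^ (M + 1)) {s : ℂ}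
    (hs : -(M : ℝ) < s.re) :
    lerchHalfPlane c z a v (M + 1) s = lerchHalfPlane c z a v M s := by
  have hs' : 0 < (s + (M : ℂ)).re := by simp; linarith
  have h1 := hasMellin_exp_neg_mul_cpow hv (M : ℂ) hs'
  have h2 := hasMellin_const_smul h1.1 (c M * ((-1) ^ M / (M.factorial : ℂ)))
  have h3 := hasMellin_add h2.1 (mellinConvergent_lerchKernel (a := a) hz hv hB
    (s := s) (by push_cast; linarith))
  have h4 : (fun t : ℝ => (c M * ((-1) ^ M / (M.factorial : ℂ))) •
      ((t : ℂ) ^ (M : ℂ) * exp (-(v * t))) + lerchKernel c z (M + 1) a v t)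
      = lerchKernel c z M a v := by
    funext t
    simp only [lerchKernel, lerchRem, Finset.sum_range_succ, cpow_natCast, smul_eq_mul]
    rw [neg_pow (t : ℂ) M]
    ring
  rw [h4] at h3
  have h5 := inv_Gamma_eq_prod_mul s M
  have hG : Gamma (s + M) ≠ 0 := Gamma_ne_zero_of_re_pos hs'
  rw [lerchHalfPlane, lerchHalfPlane, h3.2, Finset.sum_range_succ, h2.2, h1.2, mul_add, smul_eq_mul]
  have h6 : (Gamma s)⁻¹ * (c M * ((-1) ^ M / (M.factorial : ℂ)) *
      (Gamma (s + M) * (v : ℂ) ^ (-(s + M)))) = c M * ((-1) ^ M / (M.factorial : ℂ)) *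
      ((∏ j ∈ Finset.range M, (s + j)) * (v : ℂ) ^ (-(s + M))) := by
    rw [h5]
    field_simp
  rw [h6]
  ring

lemma lerchHalfPlane_eq (hz : ‖z‖ = 1) (hv : 0 < v)
    (hB : ∀ M : ℕ, 1 ≤ M → ∀ t : ℝ, 0 < t → ‖lerchRem c z M a t‖ ≤ B M * t ^ M)
    {M K : ℕ} (hMK : M ≤ K) {s : ℂ} (hs : -(M : ℝ) < s.re) :
    lerchHalfPlane c z a v K s = lerchHalfPlane c z a v M s := by
  induction K, hMK using Nat.le_induction with
  | base => rfl
  | succ K hK ih =>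
    rw [← ih]
    have : (M : ℝ) ≤ K := by exact_mod_cast hK
    exact lerchHalfPlane_succ hz hv (hB (K + 1) (by omega)) (by linarith)

lemma differentiableAt_lerchHalfPlane (hz : ‖z‖ = 1) (hv : 0 < v) {M : ℕ}
    (hB : ∀ t : ℝ, 0 < t → ‖lerchRem c z M a t‖ ≤ B M * t ^ M) {s : ℂ} (hs : -(M : ℝ) < s.re)
    (hs1 : z ≠ 1 ∨ s ≠ 1) : DifferentiableAt ℂ (lerchHalfPlane c z a v M) s := by
  have hv0 : (v : ℂ) ≠ 0 := by exact_mod_cast hv.ne'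
  unfold lerchHalfPlane
  refine DifferentiableAt.add (DifferentiableAt.add ?_ ?_) ?_
  · rcases hs1 with h | h
    · simp [lerchResidue, h]
    · refine DifferentiableAt.div ?_ (by fun_prop) (sub_ne_zero.mpr h)
      refine DifferentiableAt.const_mul ?_ _
      exact DifferentiableAt.const_cpow (by fun_prop) (Or.inl hv0)
  · refine DifferentiableAt.fun_sum fun m _ => DifferentiableAt.const_mul ?_ _
    refine DifferentiableAt.mul (by fun_prop) ?_
    exact DifferentiableAt.const_cpow (by fun_prop) (Or.inl hv0)
  · exact (differentiable_one_div_Gamma s).mul (differentiableAt_mellin_lerchKernel hz hv hB hs)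

/-- Expanding `1 / (1 - z e^{-t})` geometrically and taking Mellin transforms termwise gives the
Lerch series. Splitting the same integrand into its `1 / t` part, constant part and remainder gives
the right side. -/
lemma hasSum_lerchHalfPlane_one (hz : ‖z‖ = 1) (hv : 0 < v)
    (hB : ∀ t : ℝ, 0 < t → ‖lerchRem c z 1 a t‖ ≤ B 1 * t ^ 1) {s : ℂ} (hs : 1 < s.re) :
    HasSum (fun k : ℕ => z ^ k / ((k : ℂ) + ((v : ℂ) + (a : ℂ))) ^ s)
      (lerchHalfPlane c z a v 1 s) := by
  have hG : Gamma s ≠ 0 := Gamma_ne_zero_of_re_pos (by linarith)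
  have hva : 0 < v + a := by positivity
  have h1 := hasSum_mellin (a := fun k : ℕ => z ^ k) (p := fun k : ℕ => (k : ℝ) + (v + a))
    (F := fun t : ℝ => exp (-(v * t)) * (exp (-(a * t)) / (1 - z * exp (-t)))) (s := s)
    (fun k => Or.inr (by positivity)) (by linarith) ?_ ?_
  · have h2 := h1.mul_left (Gamma s)⁻¹
    have e1 (k : ℕ) : (Gamma s)⁻¹ * (Gamma s * z ^ k / (((k : ℝ) + (v + a) : ℝ) : ℂ) ^ s)
        = z ^ k / ((k : ℂ) + ((v : ℂ) + (a : ℂ))) ^ s := by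
      push_cast
      field_simp
    simp only [e1] at h2
    convert! h2 using 1
    have m0 := hasMellin_exp_neg_mul_cpow hv 0 (s := s) (by simp; linarith)
    have m1 := hasMellin_exp_neg_mul_cpow hv (-1) (s := s) (by simp; linarith)
    have n0 := hasMellin_const_smul m0.1 (c 0)
    have n1 := hasMellin_const_smul m1.1 (lerchResidue z)
    have n2 := hasMellin_add n1.1 n0.1
    have n3 := hasMellin_add n2.1 (mellinConvergent_lerchKernel (a := a) hz hv hB
      (s := s) (by push_cast; linarith))
    have e2 : (fun t : ℝ => exp (-(v * t)) * (exp (-(a * t)) / (1 - z * exp (-t))))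
        = fun t : ℝ => lerchResidue z • ((t : ℂ) ^ (-1 : ℂ) * exp (-(v * t))) +
          c 0 • ((t : ℂ) ^ (0 : ℂ) * exp (-(v * t))) + lerchKernel c z 1 a v t := by
      funext t
      simp only [lerchKernel, lerchRem, smul_eq_mul, cpow_neg_one, cpow_zero, Finset.sum_range_one,
        pow_zero, Nat.factorial_zero, Nat.cast_one]
      ring
    rw [e2, n3.2, n2.2, n1.2, n0.2, m1.2, m0.2, lerchHalfPlane]
    simp only [Finset.sum_range_one, pow_zero, Nat.factorial_zero, Nat.cast_one,
      Finset.prod_range_zero, Nat.cast_zero, smul_eq_mul, add_zero]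
    have e3 : Gamma s = (s - 1) * Gamma (s + -1) := by
      have := Gamma_add_one (s - 1) (sub_ne_zero.mpr (by rintro rfl; simp at hs))
      rw [sub_add_cancel] at this
      rw [this, sub_eq_add_neg]
    have e4 : s - 1 ≠ 0 := fun h => hG (by rw [e3, h, zero_mul])
    have e5 : Gamma (s + -1) ≠ 0 := fun h => hG (by rw [e3, h, mul_zero])
    rw [show -(s + -1) = 1 - s by ring, mul_add, mul_add]
    congr 1
    congr 1
    · rw [e3]; field_simp
    · field_simp
  · intro t ht
    have ht : 0 < t := ht
    have h3 : ‖z * exp (-t)‖ < 1 := by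
      rw [norm_mul, hz, one_mul, norm_exp, Real.exp_lt_one_iff]
      simpa using ht
    have h4 := ((hasSum_geometric_of_norm_lt_one h3).mul_left (exp (-(v * t)) * exp (-(a * t))))
    convert! h4 using 1
    · funext k
      rw [mul_pow, ← exp_nat_mul, ofReal_exp, ← exp_add, mul_left_comm, ← exp_add]
      push_cast
      ring_nf
    · rw [mul_assoc, div_eq_mul_inv]
  · simp only [norm_pow, hz, one_pow]
    have h5 := Real.summable_one_div_nat_add_rpow (v + a) s.re |>.mpr hs
    refine h5.congr fun k => ?_
    rw [abs_of_pos (by positivity)]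

lemma exists_isLerchContinuation (hz : ‖z‖ = 1) (hv : 0 < v)
    (hB : ∀ M : ℕ, 1 ≤ M → ∀ t : ℝ, 0 < t → ‖lerchRem c z M a t‖ ≤ B M * t ^ M) :
    ∃ f : ℂ → ℂ, IsLerchContinuation z ((v : ℂ) + (a : ℂ)) f ∧
      ∀ M : ℕ, 1 ≤ M → ∀ s : ℂ, -(M : ℝ) < s.re → f s = lerchHalfPlane c z a v M s := by
  -- A truncation order with `Re s > -K s`; the half-plane formulas agree on overlaps and glue.
  let K (s : ℂ) : ℕ := ⌊|s.re|⌋₊ + 1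
  have hK (s : ℂ) : -(K s : ℝ) < s.re := by
    have := Nat.lt_floor_add_one |s.re|
    have := neg_abs_le s.re
    simp only [K]
    push_cast
    linarith
  have hf : ∀ M : ℕ, 1 ≤ M → ∀ s : ℂ, -(M : ℝ) < s.re →
      lerchHalfPlane c z a v (K s) s = lerchHalfPlane c z a v M s := by
    intro M _ s hs
    rcases le_total M (K s) with h | h
    · exact lerchHalfPlane_eq hz hv hB h hs
    · exact (lerchHalfPlane_eq hz hv hB h (hK s)).symm
  refine ⟨fun s => lerchHalfPlane c z a v (K s) s, ⟨?_, ?_⟩, hf⟩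
  · intro s hs
    refine DifferentiableAt.differentiableWithinAt ?_
    have hd := differentiableAt_lerchHalfPlane hz hv (hB (K s) (by simp [K])) (hK s) hs
    refine hd.congr_of_eventuallyEq ?_
    filter_upwards [(isOpen_lt continuous_const continuous_re).mem_nhds (hK s)] with w hw
    exact hf (K s) (by simp [K]) w hw
  · intro s hs
    simp only
    rw [hf 1 le_rfl s (by push_cast; linarith)]
    exact hasSum_lerchHalfPlane_one hz hv (hB 1 le_rfl) hs

end Continuation

/-- Identity theorem: both functions equal the series near `s = 2`, and the plane, even with one
point removed, is connected. -/
lemma IsLerchContinuation.eq {z v : ℂ} {f g : ℂ → ℂ} (hf : IsLerchContinuation z v f)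
    (hg : IsLerchContinuation z v g) {s : ℂ} (hs : z ≠ 1 ∨ s ≠ 1) : f s = g s := by
  have hU : IsOpen {s : ℂ | z ≠ 1 ∨ s ≠ 1} := by
    by_cases h : z = 1
    · have : {s : ℂ | z ≠ 1 ∨ s ≠ 1} = {1}ᶜ := by ext; simp [h]
      rw [this]; exact isOpen_compl_singleton
    · simp [h]
  have hc : IsPreconnected {s : ℂ | z ≠ 1 ∨ s ≠ 1} := by
    by_cases h : z = 1
    · simpa [h] using! (isConnected_compl_singleton_of_one_lt_rank (by simp) (1 : ℂ)).isPreconnected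
    · simpa [h] using isPreconnected_univ
  refine (hf.1.analyticOnNhd hU).eqOn_of_preconnected_of_eventuallyEq (hg.1.analyticOnNhd hU) hc
    (z₀ := 2) (Or.inr (by norm_num)) ?_ hs
  filter_upwards [(isOpen_lt continuous_const continuous_re).mem_nhds
    (show (1 : ℝ) < (2 : ℂ).re by norm_num)] with w hw
  exact (hf.2 w hw).unique (hg.2 w hw)

lemma IsLerchContinuation.lerchContinuation_eq {z v : ℂ} {f : ℂ → ℂ}
    (hf : IsLerchContinuation z v f) {s : ℂ} (hs : z ≠ 1 ∨ s ≠ 1) :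
    lerchContinuation z s v = f s := by
  have h : ∃ f, IsLerchContinuation z v f := ⟨f, hf⟩
  rw [lerchContinuation, dif_pos h]
  exact h.choose_spec.eq hf hs

lemma isLerchContinuation_riemannZeta : IsLerchContinuation 1 1 riemannZeta := by
  constructor
  · intro s hs
    exact (differentiableAt_riemannZeta (by simpa using hs)).differentiableWithinAt
  · intro s hs
    rw [zeta_eq_tsum_one_div_nat_add_one_cpow hs]
    simp only [one_pow]
    refine Summable.hasSum ?_
    have := (summable_nat_add_iff 1).mpr (Complex.summable_one_div_nat_cpow.mpr hs)
    simpa using this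

/-! ### Pochhammer products and `1/Γ` at `-n` -/

lemma prod_range_neg_add_eq_descFactorial (n m : ℕ) :
    ∏ j ∈ Finset.range m, (-(n : ℂ) + j) = (-1) ^ m * (n.descFactorial m : ℂ) := by
  induction m with
  | zero => simp
  | succ m ih =>
    rw [Finset.prod_range_succ, ih, Nat.descFactorial_succ]
    rcases le_or_gt m n with h | h
    · push_cast [Nat.cast_sub h]; ring
    · rw [Nat.descFactorial_of_lt h]; simp

lemma neg_one_pow_div_mul_prod_eq_choose (n m : ℕ) :
    (-1) ^ m / (m.factorial : ℂ) * ∏ j ∈ Finset.range m, (-(n : ℂ) + j) = (n.choose m : ℂ) := by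
  have hf : (m.factorial : ℂ) ≠ 0 := by exact_mod_cast m.factorial_ne_zero
  have h2 : ((-1 : ℂ) ^ m) * (-1) ^ m = 1 := by rw [← mul_pow]; simp
  rw [prod_range_neg_add_eq_descFactorial, Nat.descFactorial_eq_factorial_mul_choose]
  push_cast
  field_simp
  linear_combination (n.choose m : ℂ) * h2

/-- No factor vanishes at `-n`, and the logarithmic derivative there is `∑_{j < m} 1 / (j - n) =
H_{n-m} - H_n`. -/
lemma hasDerivAt_prod_range_add_of_le (n m : ℕ) (h : m ≤ n) :
    HasDerivAt (fun s : ℂ => ∏ j ∈ Finset.range m, (s + j))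
      ((∏ j ∈ Finset.range m, (-(n : ℂ) + j)) * ((harmonic (n - m) : ℂ) - (harmonic n : ℂ)))
      (-(n : ℂ)) := by
  induction m with
  | zero => simpa using hasDerivAt_const (-(n : ℂ)) (1 : ℂ)
  | succ m ih =>
    have h1 := (ih (by omega)).mul ((hasDerivAt_id (-(n : ℂ))).add_const (m : ℂ))
    simp only [Finset.prod_range_succ]
    convert! h1 using 1
    obtain ⟨k, rfl⟩ : ∃ k, n = m + 1 + k := ⟨n - (m + 1), by omega⟩
    rw [show m + 1 + k - (m + 1) = k by omega, show m + 1 + k - m = k + 1 by omega, harmonic_succ]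
    have : (k : ℂ) + 1 ≠ 0 := Nat.cast_add_one_ne_zero k
    push_cast
    simp only [id]
    field_simp
    ring

/-- Only the factor `j = n` vanishes at `-n`, so the derivative is the product of the others. -/
lemma hasDerivAt_prod_range_add_of_lt (n l : ℕ) :
    HasDerivAt (fun s : ℂ => ∏ j ∈ Finset.range (n + 1 + l), (s + j))
      ((-1) ^ n * (n.factorial : ℂ) * (l.factorial : ℂ)) (-(n : ℂ)) := by
  induction l with
  | zero =>
    have h1 := (hasDerivAt_prod_range_add_of_le n n le_rfl).mul
      ((hasDerivAt_id (-(n : ℂ))).add_const (n : ℂ))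
    simp only [add_zero, Finset.prod_range_succ]
    convert! h1 using 1
    rw [prod_range_neg_add_eq_descFactorial, Nat.descFactorial_self]
    simp
  | succ l ih =>
    have h1 := ih.mul ((hasDerivAt_id (-(n : ℂ))).add_const ((n + 1 + l : ℕ) : ℂ))
    simp only [← add_assoc]
    simp only [Finset.prod_range_succ _ (n + 1 + l)]
    convert! h1 using 1
    rw [prod_range_neg_add_eq_descFactorial, Nat.descFactorial_of_lt (by omega),
      Nat.factorial_succ]
    push_cast
    simp only [id]
    ring

lemma inv_Gamma_neg_nat (n : ℕ) : (Gamma (-(n : ℂ)))⁻¹ = 0 := by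
  rw [Gamma_neg_nat_eq_zero, inv_zero]

lemma hasDerivAt_inv_Gamma_neg_nat (n : ℕ) :
    HasDerivAt (fun s : ℂ => (Gamma s)⁻¹) ((-1) ^ n * (n.factorial : ℂ)) (-(n : ℂ)) := by
  have h1 := hasDerivAt_prod_range_add_of_lt n 0
  have h2 : DifferentiableAt ℂ (fun s : ℂ => (Gamma (s + (n + 1 : ℕ)))⁻¹) (-(n : ℂ)) :=
    (differentiable_one_div_Gamma.comp (differentiable_id.add_const ((n + 1 : ℕ) : ℂ)) _)
  have h3 := h1.mul h2.hasDerivAt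
  have h4 : (fun s : ℂ => (Gamma s)⁻¹) = fun s : ℂ => (∏ j ∈ Finset.range (n + 1 + 0), (s + j)) *
      (Gamma (s + (n + 1 : ℕ)))⁻¹ := funext fun s => inv_Gamma_eq_prod_mul s (n + 1)
  rw [h4]
  convert! h3 using 1
  rw [prod_range_neg_add_eq_descFactorial, Nat.descFactorial_of_lt (by omega)]
  simp

/-! ### Values and derivatives at `s = -n` -/

section Values

variable {c : ℕ → ℂ} {z : ℂ} {a : ℕ} {B : ℕ → ℝ} {v : ℝ}

lemma lerchHalfPlane_neg_nat (n : ℕ) :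
    lerchHalfPlane c z a v (n + 1) (-(n : ℂ)) = -(lerchResidue z * (v : ℂ) ^ (n + 1) / (n + 1)) +
      ∑ m ∈ Finset.range (n + 1), (n.choose m : ℂ) * c m * (v : ℂ) ^ (n - m) := by
  have hn : (n : ℂ) + 1 ≠ 0 := Nat.cast_add_one_ne_zero n
  rw [lerchHalfPlane, inv_Gamma_neg_nat, zero_mul, add_zero]
  congr 1
  · rw [show (1 : ℂ) - -(n : ℂ) = ((n + 1 : ℕ) : ℂ) by push_cast; ring, cpow_natCast,
      show -(n : ℂ) - 1 = -(n + 1) by ring, div_neg]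
  · refine Finset.sum_congr rfl fun m hm => ?_
    have hm : m ≤ n := by simpa [Nat.lt_succ_iff] using hm
    rw [← neg_one_pow_div_mul_prod_eq_choose, show -(-(n : ℂ) + m) = ((n - m : ℕ) : ℂ) by
      push_cast [Nat.cast_sub hm]; ring, cpow_natCast]
    ring

lemma hasDerivAt_cpow_neg_add (hv : 0 < v) (n m : ℕ) :
    HasDerivAt (fun s : ℂ => (v : ℂ) ^ (-(s + m)))
      (-(Real.log v : ℂ) * (v : ℂ) ^ ((n : ℤ) - m)) (-(n : ℂ)) := by
  have hv0 : (v : ℂ) ≠ 0 := by exact_mod_cast hv.ne'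
  have h1 : HasDerivAt (fun s : ℂ => -(s + (m : ℂ))) (-1) (-(n : ℂ)) :=
    ((hasDerivAt_id _).add_const _).neg
  have h2 := h1.const_cpow (c := (v : ℂ)) (Or.inl hv0)
  convert! h2 using 1
  rw [show -(-(n : ℂ) + m) = (((n : ℤ) - m : ℤ) : ℂ) by push_cast; ring, cpow_intCast,
    ofReal_log hv.le]
  ring

/-- Since `1/Γ` vanishes at `-n`, the product rule leaves only the value, not the derivative, of the
Mellin transform. For the same reason the terms with `m > n` carry no logarithm. -/
lemma hasDerivAt_lerchHalfPlane (hz : ‖z‖ = 1) (hv : 0 < v) (n N : ℕ)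
    (hB : ∀ t : ℝ, 0 < t → ‖lerchRem c z (n + 1 + N) a t‖ ≤ B (n + 1 + N) * t ^ (n + 1 + N)) :
    HasDerivAt (lerchHalfPlane c z a v (n + 1 + N))
      (lerchResidue z * ((v : ℂ) ^ (n + 1) *
          ((Real.log v : ℂ) / ((n : ℂ) + 1) - 1 / ((n : ℂ) + 1) ^ 2))
        + ∑ m ∈ Finset.range (n + 1), (v : ℂ) ^ m * (n.choose m : ℂ) * c (n - m) *
            (-(Real.log v : ℂ) + (harmonic m : ℂ) - (harmonic n : ℂ))
        + ∑ m ∈ Finset.Ico 1 (N + 1), c (n + m) /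
            ((-(v : ℂ)) ^ m * (m : ℂ) * ((m + n).choose n : ℂ))
        + (-1) ^ n * (n.factorial : ℂ) * mellin (lerchKernel c z (n + 1 + N) a v) (-(n : ℂ)))
      (-(n : ℂ)) := by
  have hv0 : (v : ℂ) ≠ 0 := by exact_mod_cast hv.ne'
  have hn : (n : ℂ) + 1 ≠ 0 := Nat.cast_add_one_ne_zero n
  unfold lerchHalfPlane
  have hP : HasDerivAt (fun s : ℂ => lerchResidue z * (v : ℂ) ^ (1 - s) / (s - 1))
      (lerchResidue z * ((v : ℂ) ^ (n + 1) *
          ((Real.log v : ℂ) / ((n : ℂ) + 1) - 1 / ((n : ℂ) + 1) ^ 2))) (-(n : ℂ)) := by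
    have h1 : HasDerivAt (fun s : ℂ => 1 - s) (-1) (-(n : ℂ)) := by
      simpa using (hasDerivAt_id (-(n : ℂ))).const_sub 1
    have h2 := ((h1.const_cpow (c := (v : ℂ)) (Or.inl hv0)).const_mul (lerchResidue z)).div
      ((hasDerivAt_id (-(n : ℂ))).sub_const 1) (by
        simp only [id]; intro h; apply hn; linear_combination -h)
    convert! h2 using 1
    simp only [id]
    rw [show (1 : ℂ) - -(n : ℂ) = ((n + 1 : ℕ) : ℂ) by push_cast; ring, cpow_natCast,
      show -(n : ℂ) - 1 = -(n + 1) by ring, ofReal_log hv.le]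
    field_simp
  have hR : HasDerivAt (fun s : ℂ => (Gamma s)⁻¹ * mellin (lerchKernel c z (n + 1 + N) a v) s)
      ((-1) ^ n * (n.factorial : ℂ) * mellin (lerchKernel c z (n + 1 + N) a v) (-(n : ℂ)))
      (-(n : ℂ)) := by
    have h1 := (differentiableAt_mellin_lerchKernel hz hv hB (s := -(n : ℂ)) (by
      push_cast; simp; linarith [Nat.cast_nonneg (α := ℝ) N])).hasDerivAt
    convert! (hasDerivAt_inv_Gamma_neg_nat n).mul h1 using 1
    rw [inv_Gamma_neg_nat]
    ring
  refine HasDerivAt.add ?_ hR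
  rw [add_assoc (lerchResidue z * _)]
  refine HasDerivAt.add hP ?_
  let T (m : ℕ) (s : ℂ) : ℂ := c m * ((-1) ^ m / (m.factorial : ℂ)) *
      ((∏ j ∈ Finset.range m, (s + j)) * (v : ℂ) ^ (-(s + m)))
  have hT1 (m : ℕ) (hm : m ≤ n) : HasDerivAt (T m) ((v : ℂ) ^ (n - m) * (n.choose m : ℂ) * c m *
            (-(Real.log v : ℂ) + (harmonic (n - m) : ℂ) - (harmonic n : ℂ))) (-(n : ℂ)) := by
    have h1 := ((hasDerivAt_prod_range_add_of_le n m hm).mul (hasDerivAt_cpow_neg_add hv n m)).const_mul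
      (c m * ((-1) ^ m / (m.factorial : ℂ)))
    convert! h1 using 1
    rw [show -(-(n : ℂ) + m) = ((n - m : ℕ) : ℂ) by push_cast [Nat.cast_sub hm]; ring, cpow_natCast,
      show (n : ℤ) - m = ((n - m : ℕ) : ℤ) by omega, zpow_natCast,
      ← neg_one_pow_div_mul_prod_eq_choose]
    ring
  have hT2 (l : ℕ) : HasDerivAt (T (n + 1 + l)) (c (n + (1 + l)) /
      ((-(v : ℂ)) ^ (1 + l) * ((1 + l : ℕ) : ℂ) * ((1 + l + n).choose n : ℂ))) (-(n : ℂ)) := by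
    have h1 := ((hasDerivAt_prod_range_add_of_lt n l).mul
      (hasDerivAt_cpow_neg_add hv n (n + 1 + l))).const_mul
      (c (n + 1 + l) * ((-1) ^ (n + 1 + l) / ((n + 1 + l).factorial : ℂ)))
    convert! h1 using 1
    rw [prod_range_neg_add_eq_descFactorial, Nat.descFactorial_of_lt (by omega),
      show -(-(n : ℂ) + (n + 1 + l : ℕ)) = -((1 + l : ℕ) : ℂ) by push_cast; ring, cpow_neg,
      cpow_natCast]
    have hch : ((1 + l + n).choose n : ℂ) * (n.factorial : ℂ) * ((1 + l : ℕ) * (l.factorial : ℂ))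
        = ((n + 1 + l).factorial : ℂ) := by
      have h3 := Nat.add_choose_mul_factorial_mul_factorial (1 + l) n
      rw [show 1 + l + n = n + 1 + l by ring] at h3 ⊢
      rw [Nat.add_comm 1 l, Nat.factorial_succ] at h3
      rw [← h3]
      push_cast
      ring
    have q1 : ((n + 1 + l).factorial : ℂ) ≠ 0 := by exact_mod_cast (n + 1 + l).factorial_ne_zero
    rw [← hch] at q1 ⊢
    have q2 : ((1 + l + n).choose n : ℂ) ≠ 0 := fun h => q1 (by rw [h]; simp)
    have q3 : (n.factorial : ℂ) ≠ 0 := by exact_mod_cast n.factorial_ne_zero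
    have q4 : (l.factorial : ℂ) ≠ 0 := by exact_mod_cast l.factorial_ne_zero
    have q5 : ((1 + l : ℕ) : ℂ) ≠ 0 := by exact_mod_cast (by omega : 1 + l ≠ 0)
    rw [← add_assoc, neg_pow (v : ℂ)]
    have q6 : ((-1 : ℂ) ^ n) * (-1) ^ n = 1 := by rw [← mul_pow]; simp
    have q7 : ((-1 : ℂ) ^ l) * (-1) ^ l = 1 := by rw [← mul_pow]; simp
    have q8 : ((-1 : ℂ) ^ l) ≠ 0 := by simp
    simp only [pow_add, pow_one, Nat.cast_zero, mul_zero, zero_mul, add_zero]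
    field_simp
    linear_combination c (n + 1 + l) * ((-1 : ℂ) ^ n * (-1 : ℂ) ^ n * q7 + q6)
  have hsum : ∀ f : ℕ → ℂ, ∑ m ∈ Finset.Ico 1 (N + 1), f m = ∑ l ∈ Finset.range N, f (1 + l) := by
    intro f
    rw [Finset.sum_Ico_eq_sum_range, Nat.add_sub_cancel]
  rw [hsum]
  -- The reflection `m ↦ n - m` indexes the terms by the power of `v`.
  have hflip : ∑ m ∈ Finset.range (n + 1), (v : ℂ) ^ m * (n.choose m : ℂ) * c (n - m) *
            (-(Real.log v : ℂ) + (harmonic m : ℂ) - (harmonic n : ℂ))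
      = ∑ m ∈ Finset.range (n + 1), (v : ℂ) ^ (n - m) * (n.choose m : ℂ) * c m *
            (-(Real.log v : ℂ) + (harmonic (n - m) : ℂ) - (harmonic n : ℂ)) := by
    rw [← Finset.sum_flip]
    refine Finset.sum_congr rfl fun m hm => ?_
    have hm : m ≤ n := by simpa [Nat.lt_succ_iff] using hm
    rw [Nat.choose_symm hm, Nat.sub_sub_self hm]
  rw [hflip]
  simp only [Finset.sum_range_add _ (n + 1) N]
  exact (HasDerivAt.fun_sum fun m hm => hT1 m (by simpa [Nat.lt_succ_iff] using hm)).add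
    (HasDerivAt.fun_sum fun l _ => hT2 l)

lemma lerchPhi_eq_lerchHalfPlane (hz : ‖z‖ = 1) (hv : 0 < v)
    (hB : ∀ M : ℕ, 1 ≤ M → ∀ t : ℝ, 0 < t → ‖lerchRem c z M a t‖ ≤ B M * t ^ M)
    {M : ℕ} (hM : 1 ≤ M) {s : ℂ} (hs : -(M : ℝ) < s.re) (hs1 : z ≠ 1 ∨ s ≠ 1) :
    lerchPhi z s ((v : ℂ) + (a : ℂ)) = lerchHalfPlane c z a v M s := by
  obtain ⟨f, hf, hfM⟩ := exists_isLerchContinuation hz hv hB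
  have h0 : (v : ℂ) + (a : ℂ) ≠ 0 := by
    have : 0 < v + a := by positivity
    exact_mod_cast this.ne'
  rw [lerchPhi, if_neg h0, hf.lerchContinuation_eq hs1, hfM M hM s hs]

lemma lerchPhi_neg_nat_add (hz : ‖z‖ = 1) (hv : 0 < v)
    (hB : ∀ M : ℕ, 1 ≤ M → ∀ t : ℝ, 0 < t → ‖lerchRem c z M a t‖ ≤ B M * t ^ M) (n : ℕ) :
    lerchPhi z (-(n : ℂ)) ((v : ℂ) + (a : ℂ)) =
      -(lerchResidue z * (v : ℂ) ^ (n + 1) / (n + 1)) +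
        ∑ m ∈ Finset.range (n + 1), (n.choose m : ℂ) * c m * (v : ℂ) ^ (n - m) := by
  rw [lerchPhi_eq_lerchHalfPlane hz hv hB (M := n + 1) (by omega) (by push_cast; simp),
    lerchHalfPlane_neg_nat]
  right
  intro h
  have := congrArg re h
  simp at this
  linarith [Nat.cast_nonneg (α := ℝ) n]

end Values

/-- Since `(v + 1) + a = v + (a + 1)`, the polynomial for `a` at `v + 1` agrees with the one for `a
+ 1` at `v`. As `v → 0` the latter reduces to its constant term `c (a + 1) n`. The case `a = 0` is
the defining convention at `v = 0`. -/
lemma lerchPhi_neg_nat {c : ℕ → ℕ → ℂ} {z : ℂ} {B : ℕ → ℕ → ℝ} (hz : ‖z‖ = 1)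
    (hc : ∀ m : ℕ, c 0 m = (0 : ℂ) ^ m + z * c 1 m)
    (hB : ∀ a M : ℕ, 1 ≤ M → ∀ t : ℝ, 0 < t → ‖lerchRem (c a) z M a t‖ ≤ B a M * t ^ M)
    (a n : ℕ) : lerchPhi z (-(n : ℂ)) (a : ℂ) = c a n := by
  have hsucc (a : ℕ) : lerchPhi z (-(n : ℂ)) ((a + 1 : ℕ) : ℂ) = c (a + 1) n := by
    let V (a : ℕ) (v : ℝ) : ℂ := -(lerchResidue z * (v : ℂ) ^ (n + 1) / (n + 1)) +
        ∑ m ∈ Finset.range (n + 1), (n.choose m : ℂ) * c a m * (v : ℂ) ^ (n - m)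
    have hV (a : ℕ) {v : ℝ} (hv : 0 < v) :
        lerchPhi z (-(n : ℂ)) ((v : ℂ) + (a : ℂ)) = V a v :=
      lerchPhi_neg_nat_add hz hv (hB a) n
    have hcont (a : ℕ) : Continuous (V a) := by
      simp only [V]; fun_prop
    have h1 : Tendsto (fun v : ℝ => V a (v + 1)) (𝓝[>] 0) (𝓝 (V a 1)) := by
      have : Continuous fun v : ℝ => V a (v + 1) := (hcont a).comp (by fun_prop)
      have h := (this.tendsto 0).mono_left (nhdsWithin_le_nhds (s := Ioi 0))
      simpa using h
    have h2 : Tendsto (V (a + 1)) (𝓝[>] 0) (𝓝 (V (a + 1) 0)) :=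
      ((hcont (a + 1)).tendsto 0).mono_left nhdsWithin_le_nhds
    have h3 : (fun v : ℝ => V a (v + 1)) =ᶠ[𝓝[>] 0] V (a + 1) := by
      filter_upwards [self_mem_nhdsWithin] with v hv
      have hv : 0 < v := hv
      rw [← hV (a + 1) hv, ← hV a (by linarith)]
      push_cast
      ring_nf
    have h4 : V a 1 = V (a + 1) 0 := tendsto_nhds_unique (h1.congr' h3) h2
    have h5 : V (a + 1) 0 = c (a + 1) n := by
      simp only [V]
      rw [Finset.sum_range_succ, Finset.sum_eq_zero fun m hm => ?_]
      · simp
      · have : n - m ≠ 0 := by have := Finset.mem_range.mp hm; omega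
        simp [this]
    rw [← h5, ← h4, ← hV a one_pos]
    push_cast
    ring_nf
  cases a with
  | zero =>
    have h1 := hsucc 0
    rw [lerchPhi, if_neg (by simp)] at h1
    simp only [zero_add, Nat.cast_one] at h1
    rw [lerchPhi, if_pos (by simp), h1, hc, neg_neg, cpow_natCast]
  | succ a => exact hsucc a

/-! ### Bound for the remainder and assembly -/

lemma norm_setIntegral_lt_setIntegral {f : ℝ → ℂ} {g : ℝ → ℝ} (hf : IntegrableOn f (Ioi 0))
    (hg : IntegrableOn g (Ioi 0)) (h : ∀ t : ℝ, 0 < t → ‖f t‖ < g t) :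
    ‖∫ t in Ioi 0, f t‖ < ∫ t in Ioi 0, g t := by
  refine (norm_integral_le_integral_norm f).trans_lt ?_
  rw [← sub_pos, ← integral_sub hg hf.norm]
  refine (setIntegral_pos_iff_support_of_nonneg_ae ?_ (hg.sub hf.norm)).mpr ?_
  · filter_upwards [ae_restrict_mem measurableSet_Ioi] with t ht
    exact (sub_pos.mpr (h t ht)).le
  · have : Function.support (g - fun t => ‖f t‖) ∩ Ioi 0 = Ioi 0 := by
      refine inter_eq_right.mpr fun t ht => ?_
      exact (sub_pos.mpr (h t ht)).ne'
    rw [this]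
    simp

/-- At `s = -n` the weight `t^{-n-1}` cancels all but `t^N` of the bound on the remainder, leaving a
Gamma integral. -/
lemma norm_mellin_lerchKernel_lt {c : ℕ → ℂ} {z : ℂ} {a : ℕ} {v : ℝ} (hz : ‖z‖ = 1) (hv : 0 < v)
    (n N : ℕ) {A : ℝ}
    (hA : ∀ t : ℝ, 0 < t → ‖lerchRem c z (n + 1 + N) a t‖ < A * t ^ (n + 1 + N)) :
    ‖mellin (lerchKernel c z (n + 1 + N) a v) (-(n : ℂ))‖ <
      A * ((N.factorial : ℝ) / v ^ (N + 1)) := by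
  have h1 := mellinConvergent_lerchKernel (B := fun _ => A) hz hv (fun t ht => (hA t ht).le)
    (s := -(n : ℂ)) (by push_cast; simp; linarith [Nat.cast_nonneg (α := ℝ) N])
  have h2 := Real.integral_rpow_mul_exp_neg_mul_Ioi (a := (N : ℝ) + 1) (r := v) (by positivity) hv
  have h3 : (1 / v) ^ ((N : ℝ) + 1) * Real.Gamma ((N : ℝ) + 1)
      = (N.factorial : ℝ) / v ^ (N + 1) := by
    rw [Real.Gamma_nat_eq_factorial, show (N : ℝ) + 1 = ((N + 1 : ℕ) : ℝ) by push_cast; rfl,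
      Real.rpow_natCast, one_div, inv_pow]
    field_simp
  rw [h3] at h2
  have h4 : IntegrableOn (fun t : ℝ => t ^ ((N : ℝ) + 1 - 1) * Real.exp (-(v * t))) (Ioi 0) := by
    -- A non-integrable function would have integral `0` by convention.
    refine Integrable.of_integral_ne_zero ?_
    rw [h2]
    have := N.factorial_pos
    positivity
  rw [← h2, ← integral_const_mul, mellin]
  refine norm_setIntegral_lt_setIntegral h1 (h4.const_mul A) fun t ht => ?_
  rw [smul_eq_mul, norm_mul, norm_cpow_eq_rpow_re_of_pos ht, lerchKernel, norm_mul, norm_exp,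
    add_sub_cancel_right, Real.rpow_natCast,
    show (-(n : ℂ) - 1).re = -((n + 1 : ℕ) : ℝ) by push_cast; simp; ring,
    Real.rpow_neg ht.le, Real.rpow_natCast,
    show (-((v : ℂ) * t)).re = -(v * t) by simp]
  have h5 := hA t ht
  calc (t ^ (n + 1))⁻¹ * (Real.exp (-(v * t)) * ‖lerchRem c z (n + 1 + N) a t‖)
      < (t ^ (n + 1))⁻¹ * (Real.exp (-(v * t)) * (A * t ^ (n + 1 + N))) := by gcongr
    _ = A * (t ^ N * Real.exp (-(v * t))) := by
      rw [pow_add _ (n + 1) N]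
      field_simp

/-- The remainder in the asymptotic expansion of `∂Φ/∂s (z, -n, v + a)`, for `K = -N - n`. -/
noncomputable def lerchRemainder (z : ℂ) (K : ℤ) (a n : ℕ) (v : ℝ) : ℂ :=
  (-(v : ℂ)) ^ (K.natAbs - n) * ((K.natAbs - n : ℕ) : ℂ) * (K.natAbs.choose n : ℂ) *
    ((-1) ^ n * (n.factorial : ℂ) *
      mellin (lerchKernel (fun m => lerchPhi z (-(m : ℂ)) (a : ℂ)) z K.natAbs a v) (-(n : ℂ)))

lemma exists_lerchRem_data (φ : ℝ) : ∃ c : ℕ → ℕ → ℂ,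
    (∀ a m : ℕ, lerchPhi (exp (φ * I)) (-(m : ℂ)) (a : ℂ) = c a m) ∧
    (∀ a m : ℕ, exp (φ * I) ^ a * c a m =
      c 0 m - ∑ k ∈ Finset.range a, exp (φ * I) ^ k * (k : ℂ) ^ m) ∧
    ∀ a M : ℕ, 1 ≤ M → ∀ t : ℝ, 0 < t → ‖lerchRem (c a) (exp (φ * I)) M a t‖ <
      lerchRemBound φ M a / (M.factorial : ℝ) * t ^ M := by
  obtain ⟨c, hc, hB⟩ := exists_norm_lerchRem_lt φ
  have hB' : ∀ a M : ℕ, 1 ≤ M → ∀ t : ℝ, 0 < t → ‖lerchRem (c a) (exp (φ * I)) M a t‖ <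
      lerchRemBound φ M a / (M.factorial : ℝ) * t ^ M := fun a M hM t ht =>
    (hB a M hM t ht).trans_eq (by ring)
  refine ⟨c, fun a m => lerchPhi_neg_nat (norm_exp_ofReal_mul_I φ) (fun m => ?_)
    (fun a M hM t ht => (hB' a M hM t ht).le) a m, hc, hB'⟩
  have := hc 1 m
  simp only [pow_one, Finset.sum_range_one, pow_zero, Nat.cast_zero, one_mul] at this
  linear_combination -this

lemma lerchBound_eq (φ : ℝ) {M : ℕ} (hM : 1 ≤ M) (a : ℕ) :
    lerchBound φ M a = (lerchRemBound φ M a : ℂ) := by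
  -- Taking `φ = 0`, i.e. `z = 1`, the recurrence in `a` reads `ζ(-M, a) = ζ(-M) - ∑_{k < a} k^M`.
  obtain ⟨c, hc, hrec, -⟩ := exists_lerchRem_data 0
  simp only [ofReal_zero, zero_mul, exp_zero, one_pow, one_mul] at hc hrec
  have hζ : lerchPhi 1 (-(M : ℂ)) ((0 : ℕ) : ℂ) = riemannZeta (-(M : ℂ)) := by
    have hM0 : M ≠ 0 := by omega
    rw [lerchPhi, if_pos (by simp), neg_neg, cpow_natCast, zero_pow hM0, zero_add, one_mul,
      isLerchContinuation_riemannZeta.lerchContinuation_eq]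
    right
    intro h
    have := congrArg re h
    simp at this
    linarith [Nat.cast_nonneg (α := ℝ) M]
  have h1 := hrec a M
  rw [← hc, ← hc, hζ] at h1
  have h2 := (hasSum_norm_lerchPole φ hM).tsum_eq
  rw [← ofReal_tsum] at h2
  rw [lerchBound, lerchRemBound, h1]
  push_cast
  rw [show (∑' k : ℤ, 1 / (‖lerchPole φ k‖ : ℂ) ^ (M + 1)) =
    ((∑' k : ℤ, 1 / ‖lerchPole φ k‖ ^ (M + 1) : ℝ) : ℂ) by push_cast; rfl, h2]
  ring

/-- The powers of `v` cancel, and the factorials do because `C(n+1+N, n) n! (N+1)! = (n+1+N)!`. The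
bound is therefore uniform in `v`. -/
lemma norm_lerchRemainder_lt (φ : ℝ) (a n N : ℕ) {v : ℝ} (hv : 0 < v) :
    ‖lerchRemainder (exp (φ * I)) (-((n + 1 + N : ℕ) : ℤ)) a n v‖ <
      lerchRemBound φ (n + 1 + N) a := by
  obtain ⟨c, hc, -, hB⟩ := exists_lerchRem_data φ
  have h := norm_mellin_lerchKernel_lt (norm_exp_ofReal_mul_I φ) hv n N (hB a (n + 1 + N) (by omega))
  have hM : (-((n + 1 + N : ℕ) : ℤ)).natAbs = n + 1 + N := by
    rw [Int.natAbs_neg, Int.natAbs_natCast]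
  rw [lerchRemainder, hM, show n + 1 + N - n = N + 1 by omega]
  simp only [hc]
  have hch : ((n + 1 + N).choose n : ℝ) * (n.factorial : ℝ) * ((N + 1 : ℕ) * (N.factorial : ℝ))
      = ((n + 1 + N).factorial : ℝ) := by
    have h3 := Nat.choose_mul_factorial_mul_factorial (show n ≤ n + 1 + N by omega)
    rw [show n + 1 + N - n = N + 1 by omega, Nat.factorial_succ] at h3
    exact_mod_cast h3
  have q1 : (0 : ℝ) < ((n + 1 + N).choose n : ℝ) := by
    exact_mod_cast Nat.choose_pos (by omega)
  have q3 : (0 : ℝ) < (n.factorial : ℝ) := by exact_mod_cast n.factorial_pos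
  have q4 : (0 : ℝ) < (N.factorial : ℝ) := by exact_mod_cast N.factorial_pos
  have q5 : (0 : ℝ) < ((N + 1 : ℕ) : ℝ) := by positivity
  simp only [norm_mul, norm_pow, norm_neg, norm_one, one_pow, one_mul, norm_natCast, norm_real,
    Real.norm_of_nonneg hv.le]
  calc _ < v ^ (N + 1) * ((N + 1 : ℕ) : ℝ) * ((n + 1 + N).choose n : ℝ) * ((n.factorial : ℝ) *
        (lerchRemBound φ (n + 1 + N) a / ((n + 1 + N).factorial : ℝ) *
          ((N.factorial : ℝ) / v ^ (N + 1)))) := by gcongr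
    _ = lerchRemBound φ (n + 1 + N) a := by
      rw [← hch]
      field_simp

lemma hasDerivAt_lerchPhi (φ : ℝ) (a n N : ℕ) {v : ℝ} (hv : 0 < v) (hN : 1 ≤ N) :
    HasDerivAt (fun s : ℂ => lerchPhi (exp (φ * I)) s ((v : ℂ) + (a : ℂ)))
      (lerchResidue (exp (φ * I)) * ((v : ℂ) ^ (n + 1) *
          ((Real.log v : ℂ) / ((n : ℂ) + 1) - 1 / ((n : ℂ) + 1) ^ 2))
        + ∑ m ∈ Finset.range (n + 1), (v : ℂ) ^ m * (n.choose m : ℂ) *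
            lerchPhi (exp (φ * I)) ((m : ℂ) - (n : ℂ)) (a : ℂ) *
              (-(Real.log v : ℂ) + (harmonic m : ℂ) - (harmonic n : ℂ))
        + ∑ m ∈ Finset.Ico 1 N, lerchPhi (exp (φ * I)) (-(m : ℂ) - (n : ℂ)) (a : ℂ) /
            ((-(v : ℂ)) ^ m * (m : ℂ) * ((m + n).choose n : ℂ))
        + lerchRemainder (exp (φ * I)) (-(N : ℤ) - (n : ℤ)) a n v /
            ((-(v : ℂ)) ^ N * (N : ℂ) * ((N + n).choose n : ℂ)))
      (-(n : ℂ)) := by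
  -- Stopping the sum before `m = N` corresponds to truncating the Laurent expansion at order `N +
  -- n`, hence the shift by one.
  obtain ⟨N, rfl⟩ : ∃ k, N = k + 1 := ⟨N - 1, by omega⟩
  obtain ⟨c, hc, -, hB⟩ := exists_lerchRem_data φ
  have hz := norm_exp_ofReal_mul_I φ
  generalize exp (φ * I) = z at *
  have hB' : ∀ M : ℕ, 1 ≤ M → ∀ t : ℝ, 0 < t → ‖lerchRem (c a) z M a t‖ ≤
      lerchRemBound φ M a / (M.factorial : ℝ) * t ^ M := fun M hM t ht => (hB a M hM t ht).le
  have h := hasDerivAt_lerchHalfPlane (B := fun M => lerchRemBound φ M a / (M.factorial : ℝ))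
    hz hv n N (hB' _ (by omega))
  have hre : -((n + 1 + N : ℕ) : ℝ) < (-(n : ℂ)).re := by
    push_cast; simp; linarith [Nat.cast_nonneg (α := ℝ) N]
  have h1 : (-(n : ℂ)).re < 1 := by simp; linarith [Nat.cast_nonneg (α := ℝ) n]
  have h2 := h.congr_of_eventuallyEq (f₁ := fun s : ℂ => lerchPhi z s ((v : ℂ) + (a : ℂ))) (by
    filter_upwards [(isOpen_lt continuous_const continuous_re).mem_nhds hre,
      (isOpen_lt continuous_re continuous_const).mem_nhds h1] with s hs hs1
    refine lerchPhi_eq_lerchHalfPlane hz hv hB' (by omega) hs (Or.inr ?_)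
    rintro rfl
    simp at hs1)
  convert! h2 using 1
  have hv0 : (v : ℂ) ≠ 0 := by exact_mod_cast hv.ne'
  congr 1
  · congr 1
    · congr 1
      refine Finset.sum_congr rfl fun m hm => ?_
      have hm : m ≤ n := by simpa [Nat.lt_succ_iff] using hm
      rw [← hc, show -((n - m : ℕ) : ℂ) = (m : ℂ) - n by push_cast [Nat.cast_sub hm]; ring]
    · refine Finset.sum_congr rfl fun m hm => ?_
      rw [← hc, show -((n + m : ℕ) : ℂ) = -(m : ℂ) - n by push_cast; ring]
  · have hM : (-((N + 1 : ℕ) : ℤ) - (n : ℤ)).natAbs = n + 1 + N := by omega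
    have q1 : ((n + 1 + N).choose n : ℂ) ≠ 0 := by
      exact_mod_cast (Nat.choose_pos (by omega)).ne'
    have q2 : ((N + 1 : ℕ) : ℂ) ≠ 0 := by exact_mod_cast (by omega : N + 1 ≠ 0)
    have q3 : (-(v : ℂ)) ^ (N + 1) ≠ 0 := pow_ne_zero _ (neg_ne_zero.mpr hv0)
    rw [lerchRemainder, hM, show n + 1 + N - n = N + 1 by omega,
      show N + 1 + n = n + 1 + N by omega]
    simp only [hc]
    rw [mul_div_cancel_left₀]
    exact mul_ne_zero (mul_ne_zero q3 q2) q1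

/-- This is the polynomial formula for `Φ(z, -n, v + a)`, negated and with `m` replaced by `n - m`.
-/
lemma sum_lerchPhi_eq_neg (φ : ℝ) (a n : ℕ) {v : ℝ} (hv : 0 < v) :
    lerchResidue (exp (φ * I)) * ((v : ℂ) ^ (n + 1) * (1 / ((n : ℂ) + 1))) +
      ∑ m ∈ Finset.range (n + 1), (v : ℂ) ^ m * (n.choose m : ℂ) *
        lerchPhi (exp (φ * I)) ((m : ℂ) - (n : ℂ)) (a : ℂ) * (-1)
      = -lerchPhi (exp (φ * I)) (-(n : ℂ)) ((v : ℂ) + (a : ℂ)) := by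
  obtain ⟨c, hc, -, hB⟩ := exists_lerchRem_data φ
  rw [lerchPhi_neg_nat_add (B := fun M => lerchRemBound φ M a / (M.factorial : ℝ))
    (norm_exp_ofReal_mul_I φ) hv (fun M hM t ht => (hB a M hM t ht).le), ← Finset.sum_flip,
    neg_add, neg_neg, ← Finset.sum_neg_distrib]
  congr 1
  · ring
  · refine Finset.sum_congr rfl fun m hm => ?_
    have hm : m ≤ n := by simpa [Nat.lt_succ_iff] using hm
    rw [Nat.choose_symm hm, ← hc, show ((n - m : ℕ) : ℂ) - n = -(m : ℂ) by
      push_cast [Nat.cast_sub hm]; ring]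
    ring

end LerchExpansion

theorem theorem2p1 :
    ∃ R : ℂ → ℤ → ℕ → ℕ → ℝ → ℂ, ∀ (φ : ℝ) (a n : ℕ) (z : ℂ), z = Complex.exp (φ * Complex.I) →
      -- the expansion for `z ≠ 1`
      (z ≠ 1 → ∀ N : ℕ, 1 ≤ N → ∀ v : ℝ, 0 < v →
        HasDerivAt (fun s : ℂ => lerchPhi z s ((v : ℂ) + (a : ℂ)))
          (∑ m ∈ Finset.range (n + 1), (v : ℂ) ^ m * (n.choose m : ℂ) *
              lerchPhi z ((m : ℂ) - (n : ℂ)) (a : ℂ) *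
                (-(Real.log v : ℂ) + (harmonic m : ℂ) - (harmonic n : ℂ))
            + ∑ m ∈ Finset.Ico 1 N, lerchPhi z (-(m : ℂ) - (n : ℂ)) (a : ℂ) /
                ((-(v : ℂ)) ^ m * (m : ℂ) * ((m + n).choose n : ℂ))
            + R z (-(N : ℤ) - (n : ℤ)) a n v /
                ((-(v : ℂ)) ^ N * (N : ℂ) * ((N + n).choose n : ℂ)))
          (-(n : ℂ))) ∧
      -- the expansion for `z = 1`
      (z = 1 → ∀ N : ℕ, 1 ≤ N → ∀ v : ℝ, 0 < v →
        HasDerivAt (fun s : ℂ => lerchPhi 1 s ((v : ℂ) + (a : ℂ)))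
          ((v : ℂ) ^ (n + 1) * ((Real.log v : ℂ) / ((n : ℂ) + 1) - 1 / ((n : ℂ) + 1) ^ 2)
            + ∑ m ∈ Finset.range (n + 1), (v : ℂ) ^ m * (n.choose m : ℂ) *
              lerchPhi 1 ((m : ℂ) - (n : ℂ)) (a : ℂ) *
                (-(Real.log v : ℂ) + (harmonic m : ℂ) - (harmonic n : ℂ))
            + ∑ m ∈ Finset.Ico 1 N, lerchPhi 1 (-(m : ℂ) - (n : ℂ)) (a : ℂ) /
                ((-(v : ℂ)) ^ m * (m : ℂ) * ((m + n).choose n : ℂ))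
            + R 1 (-(N : ℤ) - (n : ℤ)) a n v /
                ((-(v : ℂ)) ^ N * (N : ℂ) * ((N + n).choose n : ℂ)))
          (-(n : ℂ))) ∧
      -- the coefficient of `log v` on the right hand side, in both cases
      (z ≠ 1 → ∀ v : ℝ, 0 < v →
        ∑ m ∈ Finset.range (n + 1), (v : ℂ) ^ m * (n.choose m : ℂ) *
            lerchPhi z ((m : ℂ) - (n : ℂ)) (a : ℂ) * (-1)
          = -lerchPhi z (-(n : ℂ)) ((v : ℂ) + (a : ℂ))) ∧
      (z = 1 → ∀ v : ℝ, 0 < v →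
        (v : ℂ) ^ (n + 1) * (1 / ((n : ℂ) + 1)) +
          ∑ m ∈ Finset.range (n + 1), (v : ℂ) ^ m * (n.choose m : ℂ) *
            lerchPhi 1 ((m : ℂ) - (n : ℂ)) (a : ℂ) * (-1)
          = -lerchPhi 1 (-(n : ℂ)) ((v : ℂ) + (a : ℂ))) ∧
      -- the bound for the remainder: the constant is real and strictly exceeds `|R|`
      (∀ N : ℕ, n < N → ∀ v : ℝ, 0 < v →
        (lerchBound φ N a).im = 0 ∧
          ‖R z (-(N : ℤ)) a n v‖ < (lerchBound φ N a).re) := by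
  -- The witness is the Mellin term `(-1)^n n!` times the integral at `-n`, multiplied by the
  -- displayed denominator.
  refine ⟨lerchRemainder, ?_⟩
  rintro φ a n z rfl
  refine ⟨fun hz N hN v hv => ?_, fun hz N hN v hv => ?_, fun hz v hv => ?_, fun hz v hv => ?_,
    fun N hN v hv => ?_⟩
  · simpa [lerchResidue, hz] using hasDerivAt_lerchPhi φ a n N hv hN
  · have h := hasDerivAt_lerchPhi φ a n N hv hN
    rw [hz] at h
    simpa only [lerchResidue, if_true, one_mul] using h
  · have h := sum_lerchPhi_eq_neg φ a n hv
    rwa [lerchResidue, if_neg hz, zero_mul, zero_add] at h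
  · have h := sum_lerchPhi_eq_neg φ a n hv
    rw [hz] at h
    simpa only [lerchResidue, if_true, one_mul] using h
  · rw [lerchBound_eq φ (by omega), Complex.ofReal_im, Complex.ofReal_re]
    obtain ⟨k, rfl⟩ : ∃ k, N = n + 1 + k := ⟨N - (n + 1), by omega⟩
    exact ⟨rfl, norm_lerchRemainder_lt φ a n k hv⟩
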